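/- A \emph{square complex} is a $2$-dimensional CW complex whose $2$-cells (squares) are attached along closed edge paths of length $4$; it has \emph{immersed cells} if all these attaching paths are without backtracking (also cyclically). Maps of square complexes are combinatorial (they map every open cell homeomorphically onto an open cell, and are considered up to reparametrization of the cells); an \emph{immersion} is a locally injective combinatorial map, and automorphisms are invertible combinatorial self-maps. A square complex $X$ is \emph{locally quadric} if it is locally finite, has immersed cells, and satisfies the following conditions on disk diagrams in $X$ (combinatorial maps to $X$ from disks tiled by squares): (a) there is no reduced disk diagram in $X$ made of two squares glued along three consecutive edges (that is, the two squares of any such diagram are folded onto the same square of $X$); (b) for every immersed disk diagram made of two squares glued along two consecutive edges (two squares around an interior vertex of degree $2$), there is a disk diagram consisting of one square with the same boundary path; (c) for every immersed disk diagram made of three squares arranged around an interior vertex of degree $3$, there is a disk diagram made of two squares glued along one edge, which joins two antipodal vertices of the boundary hexagon, with the same boundary path. For $m,n\ge 1$ let $\square_{m,n}$ be the $2$-skeleton of the $(m,n)$-bisimplex: the square complex whose $1$-skeleton is the complete bipartite graph $K_{m+1,n+1}$, with exactly one square attached along every embedded $4$-cycle. For an immersion $f\colon \square_{m,n}\to X$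 let $\operatorname{Aut}(\square_{m,n}\xrightarrow{f} X)=\{\varphi\in\operatorname{Aut}(\square_{m,n}) : f\circ\varphi=f\}$. \textbf{Theorem.} Let $X$ be a compact connected locally quadric complex and let $x_0$ be a vertex of $X$. Then $\pi_1(X,x_0)$ has torsion (a nontrivial element of finite order) if and only if there are $m,n\ge 1$ and an immersion $f\colon\square_{m,n}\to X$ such that $\operatorname{Aut}(\square_{m,n}\xrightarrow{f} X)$ is nontrivial. -/

import Mathlib

open CategoryTheory

universe u v

/-- A square complex: a 2-dimensional CW complex whose 2-cells are squares attached along closed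
edge paths of length 4, encoded by its combinatorial cell structure.

* `Vert` is the set of 0-cells.
* `Edge` is the set of *oriented* 1-cells: every 1-cell gives two elements `e` and `rev e`, and
  `src e` is the initial vertex of `e`.
* `Flag` is the set of *parametrized* 2-cells: a 2-cell together with a choice of one of its four
  corners and of one of the two directions around its boundary. Every 2-cell gives exactly eight
  flags, permuted simply transitively by the dihedral group generated by `rot` (move the base
  corner one step in the chosen direction) and `flip` (keep the base corner, reverse the
  direction). The oriented edge `first q` is the first edge of the boundary path of `q`, so the
  attaching path of `q` is `first q, first (rot q), first (rot (rot q)), first (rot (rot (rot q)))`.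

No regularity is required: boundary edges of a square may be identified with each other. -/
structure SquareComplex : Type (u + 1) where
  Vert : Type u
  Edge : Type u
  Flag : Type u
  src : Edge → Vert
  rev : Edge → Edge
  rev_rev : ∀ e, rev (rev e) = e
  rev_ne : ∀ e, rev e ≠ e
  first : Flag → Edge
  rot : Flag → Flag
  flip : Flag → Flag
  rot_four : ∀ q, rot (rot (rot (rot q))) = q
  flip_flip : ∀ q, flip (flip q) = q
  rot_flip_rot : ∀ q, rot (flip (rot q)) = flip q
  /-- The next three fields say that the dihedral group acts freely: every non-trivial element of
  the dihedral group of order 8 is conjugate to, or has as a power, one of the three elements. -/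
  rot_rot_ne : ∀ q, rot (rot q) ≠ q
  flip_ne : ∀ q, flip q ≠ q
  flip_rot_ne : ∀ q, flip (rot q) ≠ q
  src_first_rot : ∀ q, src (first (rot q)) = src (rev (first q))
  first_flip : ∀ q, first (flip q) = rev (first (rot (rot (rot q))))

namespace SquareComplex

variable (X : SquareComplex.{u})

/-- The terminal vertex of an oriented edge. -/
def tgt (e : X.Edge) : X.Vert := X.src (X.rev e)

/-- The base corner of a parametrized square. -/
def base (q : X.Flag) : X.Vert := X.src (X.first q)

/-! ### Combinatorial maps, immersions, automorphisms -/

/-- A combinatorial map of square complexes: it maps every open cell homeomorphically onto an open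
cell, hence parametrized cells to parametrized cells. -/
@[ext]
structure Hom (Y : SquareComplex.{u}) (X : SquareComplex.{v}) : Type (max u v) where
  onVert : Y.Vert → X.Vert
  onEdge : Y.Edge → X.Edge
  onFlag : Y.Flag → X.Flag
  map_src : ∀ e, X.src (onEdge e) = onVert (Y.src e)
  map_rev : ∀ e, onEdge (Y.rev e) = X.rev (onEdge e)
  map_first : ∀ q, onEdge (Y.first q) = X.first (onFlag q)
  map_rot : ∀ q, onFlag (Y.rot q) = X.rot (onFlag q)
  map_flip : ∀ q, onFlag (Y.flip q) = X.flip (onFlag q)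

/-- The identity map. -/
def Hom.id (Y : SquareComplex.{u}) : Hom Y Y :=
  ⟨fun v => v, fun e => e, fun q => q, fun _ => rfl, fun _ => rfl, fun _ => rfl, fun _ => rfl,
    fun _ => rfl⟩

/-- Composition: `f.comp g` is first `g`, then `f`. -/
def Hom.comp {Z Y : SquareComplex.{u}} {X : SquareComplex.{v}} (f : Hom Y X) (g : Hom Z Y) :
    Hom Z X where
  onVert := f.onVert ∘ g.onVert
  onEdge := f.onEdge ∘ g.onEdge
  onFlag := f.onFlag ∘ g.onFlag
  map_src e := by simp [f.map_src, g.map_src]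
  map_rev e := by simp [f.map_rev, g.map_rev]
  map_first q := by simp [f.map_first, g.map_first]
  map_rot q := by simp [f.map_rot, g.map_rot]
  map_flip q := by simp [f.map_flip, g.map_flip]

/-- An immersion is a locally injective combinatorial map: at every vertex `v`, distinct oriented
edges issuing from `v` have distinct images, and so have distinct (parametrized) corners at `v`. -/
structure Hom.IsImmersion {Y : SquareComplex.{u}} {X : SquareComplex.{v}} (f : Hom Y X) :
    Prop where
  edge_inj : ∀ e e' : Y.Edge, Y.src e = Y.src e' → f.onEdge e = f.onEdge e' → e = e'
  flag_inj : ∀ q q' : Y.Flag, Y.base q = Y.base q' → f.onFlag q = f.onFlag q' → q = q'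

instance (Y : SquareComplex.{u}) : Monoid (Hom Y Y) where
  mul f g := f.comp g
  one := Hom.id Y
  mul_assoc _ _ _ := rfl
  one_mul _ := rfl
  mul_one _ := rfl

/-- The automorphism group of a square complex: the invertible combinatorial self-maps. -/
abbrev Automorphism (Y : SquareComplex.{u}) : Type u := (Hom Y Y)ˣ

/-- The automorphism group `Aut(Y → X)` of a map `f : Y → X`: the stabilizer of `f` in the
automorphism group of `Y`, acting on maps `Y → X` by precomposition. -/
def Hom.aut {Y : SquareComplex.{u}} {X : SquareComplex.{v}} (f : Hom Y X) :
    Subgroup (Automorphism Y) where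
  carrier := {φ | f.comp φ.val = f}
  one_mem' := rfl
  mul_mem' {a b} ha hb := by
    have h : f.comp (a * b : Automorphism Y).val = (f.comp a.val).comp b.val := rfl
    have ha' : f.comp a.val = f := ha
    have hb' : f.comp b.val = f := hb
    change f.comp (a * b : Automorphism Y).val = f
    rw [h, ha', hb']
  inv_mem' {a} ha := by
    have h : (f.comp a.val).comp (a⁻¹ : Automorphism Y).val = f.comp (a.val * a⁻¹.val) := rfl
    have ha' : f.comp a.val = f := ha
    rw [ha', Units.mul_inv] at h
    exact h

/-! ### Finiteness and connectedness -/

/-- A square complex is compact when it has finitely many cells. -/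
structure IsCompact : Prop where
  finite_vert : Finite X.Vert
  finite_edge : Finite X.Edge
  finite_flag : Finite X.Flag

/-- Every vertex lies on finitely many edges and corners of squares. -/
structure IsLocallyFinite : Prop where
  finite_edge : ∀ x : X.Vert, {e | X.src e = x}.Finite
  finite_flag : ∀ x : X.Vert, {q | X.base q = x}.Finite

/-- Any two vertices are joined by an edge path. -/
def IsConnected : Prop :=
  ∀ x y : X.Vert, Relation.ReflTransGen (fun a b => ∃ e, X.src e = a ∧ X.tgt e = b) x y

/-! ### The fundamental group -/

/-- The vertices of `X`, as objects of the quiver of oriented edges. -/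
def OneSkeleton (X : SquareComplex.{u}) : Type u := X.Vert

instance : Quiver.{u} X.OneSkeleton where
  Hom x y := {e : X.Edge // X.src e = x ∧ X.tgt e = y}

/-- A vertex, as an object of the category of edge paths. -/
def obj (x : X.Vert) : Paths X.OneSkeleton := x

/-- An oriented edge, as an edge path of length one. -/
def edgePath (e : X.Edge) {x y : X.Vert} (hx : X.src e = x) (hy : X.tgt e = y) :
    X.obj x ⟶ X.obj y :=
  Quiver.Hom.toPath (V := X.OneSkeleton) (a := x) (b := y) ⟨e, hx, hy⟩

/-- The boundary path of a parametrized square, as a closed edge path. -/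
def boundaryPath (q : X.Flag) : X.obj (X.base q) ⟶ X.obj (X.base q) :=
  X.edgePath (X.first q) rfl (X.src_first_rot q).symm ≫
  X.edgePath (X.first (X.rot q)) rfl (X.src_first_rot _).symm ≫
  X.edgePath (X.first (X.rot (X.rot q))) rfl (X.src_first_rot _).symm ≫
  X.edgePath (X.first (X.rot (X.rot (X.rot q)))) rfl
    ((X.src_first_rot _).symm.trans (by rw [X.rot_four]; rfl))

/-- The elementary homotopies of edge paths: a backtrack `e, rev e` is trivial, and so is the
boundary path of every square. -/
inductive ElementaryHomotopy : HomRel (Paths X.OneSkeleton)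
  | backtrack (e : X.Edge) : ElementaryHomotopy
      (X.edgePath e rfl rfl ≫ X.edgePath (X.rev e) rfl (congrArg X.src (X.rev_rev e)))
      (𝟙 (X.obj (X.src e)))
  | square (q : X.Flag) : ElementaryHomotopy (X.boundaryPath q) (𝟙 (X.obj (X.base q)))

/-- The fundamental groupoid of `X`: objects are the vertices, morphisms are the homotopy classes
of edge paths, homotopy being generated by the elementary homotopies (applied anywhere within a
path). Every morphism is invertible, the inverse being the class of the reversed path. -/
abbrev FundamentalGpd : Type u := CategoryTheory.Quotient X.ElementaryHomotopy

/-- The fundamental group `π₁(X, x)`: homotopy classes of closed edge paths at `x`. -/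
abbrev Pi1 (x : X.Vert) : Type u := Aut (⟨X.obj x⟩ : X.FundamentalGpd)

/-! ### Locally quadric complexes

A disk diagram obtained by gluing squares along edges, together with its map to `X`, is the same
thing as a family of parametrized squares of `X` (the images of the squares of the diagram) which
agree along the glued edges. -/

/-- The squares of `X` are immersed: the two boundary edges at a corner of a square are never the
same oriented edge, i.e. the boundary path of a square is a closed path without backtracking. -/
def HasImmersedCells : Prop := ∀ q : X.Flag, X.first (X.flip q) ≠ X.first q

/-- A disk diagram in `X` made of two squares glued along three consecutive edges (its boundary
path has length 2). -/
structure IsThreeEdgeDiagram (q q' : X.Flag) : Prop where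
  glue₀ : X.first q = X.first q'
  glue₁ : X.first (X.rot q) = X.first (X.rot q')
  glue₂ : X.first (X.rot (X.rot q)) = X.first (X.rot (X.rot q'))

/-- An immersed disk diagram in `X` made of two squares glued along two consecutive edges: the
squares `q = (u, v, w, p)` and `q' = (u, v, w, p')` share the edges `uv` and `vw`, so `v` is an
interior vertex of degree 2 and the boundary path is `u, p, w, p'`.
The last two fields are local injectivity at `w` and at `u`; in a complex with immersed cells they
imply local injectivity at the other vertices. -/
structure IsImmersedTwoEdgeDiagram (q q' : X.Flag) : Prop where
  glue₀ : X.first q = X.first q'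
  glue₁ : X.first (X.rot q) = X.first (X.rot q')
  inj_w : X.first (X.rot (X.rot q)) ≠ X.first (X.rot (X.rot q'))
  inj_u : X.first (X.flip q) ≠ X.first (X.flip q')

/-- The closed path `e₀, e₁, e₂, e₃` is the boundary path of a square. -/
def BoundsSquare (e₀ e₁ e₂ e₃ : X.Edge) : Prop :=
  ∃ s : X.Flag, X.first s = e₀ ∧ X.first (X.rot s) = e₁ ∧ X.first (X.rot (X.rot s)) = e₂ ∧
    X.first (X.rot (X.rot (X.rot s))) = e₃

/-- An immersed disk diagram in `X` made of three squares around an interior vertex `v` of degree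
3: the squares are `q₁ = (v, x₁, p₁, x₂)`, `q₂ = (v, x₂, p₂, x₃)`, `q₃ = (v, x₃, p₃, x₁)`, and the
boundary path is `x₁, p₁, x₂, p₂, x₃, p₃`.
The last three fields are local injectivity at `x₂`, `x₃`, `x₁`; in a complex with immersed cells
they imply local injectivity at the other vertices. -/
structure IsImmersedCornerDiagram (q₁ q₂ q₃ : X.Flag) : Prop where
  glue₂ : X.first (X.flip q₁) = X.first q₂
  glue₃ : X.first (X.flip q₂) = X.first q₃
  glue₁ : X.first (X.flip q₃) = X.first q₁
  inj₂ : X.first (X.rot (X.flip q₁)) ≠ X.first (X.rot q₂)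
  inj₃ : X.first (X.rot (X.flip q₂)) ≠ X.first (X.rot q₃)
  inj₁ : X.first (X.rot (X.flip q₃)) ≠ X.first (X.rot q₁)

/-- The closed path `e₀, …, e₅` is the boundary path of a disk diagram made of two squares
glued along an edge `d` which cuts off `e₀, e₁, e₂` from `e₃, e₄, e₅`. -/
def BoundsTwoSquares (e₀ e₁ e₂ e₃ e₄ e₅ : X.Edge) : Prop :=
  ∃ d : X.Edge, X.BoundsSquare e₀ e₁ e₂ d ∧ X.BoundsSquare e₃ e₄ e₅ (X.rev d)

/-- Locally quadric complexes. -/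
structure IsLocallyQuadric : Prop where
  locallyFinite : X.IsLocallyFinite
  immersedCells : X.HasImmersedCells
  /-- No reduced disk diagram consists of two squares glued along three consecutive edges: in every
  such diagram the two squares are mirror images of each other (map to the same square). -/
  no_three_edge : ∀ q q' : X.Flag, X.IsThreeEdgeDiagram q q' → q = q'
  /-- Two squares around an interior vertex of degree 2 can be replaced by one square with the same
  boundary path. -/
  replace_two : ∀ q q' : X.Flag, X.IsImmersedTwoEdgeDiagram q q' →
    X.BoundsSquare (X.first (X.flip q)) (X.first (X.rot (X.flip q)))
      (X.first (X.rot (X.rot q'))) (X.first (X.rot (X.rot (X.rot q'))))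
  /-- Three squares around an interior vertex of degree 3 can be replaced by two squares glued
  along an edge joining two antipodal vertices of the boundary hexagon, with the same boundary
  path. -/
  replace_three : ∀ q₁ q₂ q₃ : X.Flag, X.IsImmersedCornerDiagram q₁ q₂ q₃ →
    let a₁ := X.first (X.rot q₁)
    let b₁ := X.first (X.rot (X.rot q₁))
    let a₂ := X.first (X.rot q₂)
    let b₂ := X.first (X.rot (X.rot q₂))
    let a₃ := X.first (X.rot q₃)
    let b₃ := X.first (X.rot (X.rot q₃))
    X.BoundsTwoSquares a₁ b₁ a₂ b₂ a₃ b₃ ∨ X.BoundsTwoSquares b₁ a₂ b₂ a₃ b₃ a₁ ∨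
      X.BoundsTwoSquares a₂ b₂ a₃ b₃ a₁ b₁

end SquareComplex

/-- A group has torsion when some non-identity element has finite order. -/
def HasTorsion (G : Type*) [Group G] : Prop := ∃ g : G, g ≠ 1 ∧ IsOfFinOrder g

/-! ### The 2-skeleton of a bisimplex -/

/-- A parametrized embedded 4-cycle `a, b, c, d` in a simple graph. -/
@[ext]
structure SimpleGraph.FourCycle {V : Type u} (G : SimpleGraph V) : Type u where
  a : V
  b : V
  c : V
  d : V
  adj_ab : G.Adj a b
  adj_bc : G.Adj b c
  adj_cd : G.Adj c d
  adj_da : G.Adj d a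
  a_ne_c : a ≠ c
  b_ne_d : b ≠ d

/-- The square complex with 1-skeleton a given simple graph and exactly one square along every
embedded 4-cycle. -/
def SimpleGraph.squareCompletion {V : Type u} (G : SimpleGraph V) : SquareComplex.{u} where
  Vert := V
  Edge := G.Dart
  Flag := G.FourCycle
  src e := e.fst
  rev e := e.symm
  rev_rev e := e.symm_symm
  rev_ne e := e.symm_ne
  first q := ⟨(q.a, q.b), q.adj_ab⟩
  rot q := ⟨q.b, q.c, q.d, q.a, q.adj_bc, q.adj_cd, q.adj_da, q.adj_ab, q.b_ne_d, q.a_ne_c.symm⟩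
  flip q := ⟨q.a, q.d, q.c, q.b, q.adj_da.symm, q.adj_cd.symm, q.adj_bc.symm, q.adj_ab.symm,
    q.a_ne_c, q.b_ne_d.symm⟩
  rot_four _ := rfl
  flip_flip _ := rfl
  rot_flip_rot _ := rfl
  rot_rot_ne q h := q.a_ne_c (congrArg FourCycle.c h)
  flip_ne q h := q.b_ne_d (congrArg FourCycle.d h)
  flip_rot_ne q h := q.adj_ab.ne (congrArg FourCycle.b h)
  src_first_rot _ := rfl
  first_flip _ := rfl

/-- The 2-skeleton `□_{m,n}` of the `(m,n)`-bisimplex. The cells of the bisimplex on a bipartitioned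
set `A ⊔ B`, `|A| = m + 1`, `|B| = n + 1`, are spanned by the nonempty subsets `A' ⊔ B'` with
`|A'| ≤ 1 ↔ |B'| ≤ 1`. Those of dimension at most 2 are the singletons (vertices), the pairs
`{a, b}` (edges), and the sets `{a, a', b, b'}` (squares, with boundary the 4-cycle `a, b, a', b'`):
one square for every embedded 4-cycle of the complete bipartite graph `K_{m+1,n+1}`. -/
abbrev bisimplexTwoSkeleton (m n : ℕ) : SquareComplex.{0} :=
  (completeBipartiteGraph (Fin (m + 1)) (Fin (n + 1))).squareCompletion

/-!
The theorem is proved in the universal cover of `X`, without disk diagrams.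

*The universal cover.* Its vertices are the homotopy classes of edge paths from the base point
(`UVert`), its edges are the lifts of the edges of `X` (`UStep`). To see its metric, a second model
is built level by level: a vertex on level `n + 1` is a class of geodesic words of length `n + 1`,
where two edges ascending from level `n` have the same end if they are equal or complete to a
square whose fourth corner is on level `n - 1` (`GeodEq`). The replacement rules of a locally
quadric complex say exactly that this relation is transitive (`GeodEq.trans`); replacing three
squares around a vertex is the essential case (`GeodEq.trans_of_corner`). In the course of the same
induction squares lift to the model (`Step.close_square`), so the fundamental groupoid acts on it
(`monodromy`), and the two models agree. As the base point is arbitrary, the 1-skeleton of the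
universal cover is a simple bipartite graph with the quadrangle condition from every vertex, in
which every embedded 4-cycle bounds a square (`UStep.boundsSquare`) and in which the 6-cycle around
three squares at a vertex has a long diagonal. Such graphs are called quadric here
(`coverGraph_isQuadric`).

*Invariant bicliques.* In a quadric graph the sets of neighbours of `v` which are closer to a given
vertex have the Helly property (`exists_adj_closer_finset`). Hence, if `R` is a function on the
vertices with `dist x y + 1 ≤ R x + R y`, then the balls of radius `R x` around all `x` have a
common point, and every common point has a neighbour which is a common point as well: one walks
towards the balls which have not been reached. Given an action of a finite group, start from an
invariant function `R` and decrease it at the common points as long as it is at least 3 there; this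
keeps the condition. In the end `R ≤ 2` on the set of common points, which is therefore an
invariant set of diameter at most 2 containing an edge, and by bipartiteness a biclique
(`exists_invariant_biclique`).

*Torsion.* The group generated by a torsion element stabilizes a biclique of the universal cover,
and since it acts freely, without exchanging the ends of an edge, both sides have at least two
vertices. The projection to `X` of the biclique with all its squares is the desired immersion, on
which the torsion element induces a nontrivial automorphism. Conversely, an immersion of
`□_{m,n}` lifts to an injective map to the universal cover, and an automorphism over `X` then acts
as a deck transformation, nontrivial and of finite order.
-/

namespace SquareComplex

variable {X : SquareComplex.{u}}

/-! ### Boundary paths of squares -/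

theorem rot_flip (q : X.Flag) : X.rot (X.flip q) = X.flip (X.rot (X.rot (X.rot q))) := by
  have h := X.rot_flip_rot (X.rot (X.rot (X.rot q)))
  rwa [X.rot_four] at h

theorem first_rot_flip (q : X.Flag) :
    X.first (X.rot (X.flip q)) = X.rev (X.first (X.rot (X.rot q))) := by
  rw [rot_flip, X.first_flip, X.rot_four]

theorem first_rot_rot_flip (q : X.Flag) :
    X.first (X.rot (X.rot (X.flip q))) = X.rev (X.first (X.rot q)) := by
  rw [rot_flip, rot_flip, X.first_flip, X.rot_four, X.rot_four]

theorem first_rot_rot_rot_flip (q : X.Flag) :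
    X.first (X.rot (X.rot (X.rot (X.flip q)))) = X.rev (X.first q) := by
  rw [rot_flip, rot_flip, rot_flip, X.first_flip, X.rot_four, X.rot_four, X.rot_four]

theorem rev_injective : Function.Injective X.rev := fun a b h => by
  rw [← X.rev_rev a, h, X.rev_rev]

theorem BoundsSquare.rotate {e₀ e₁ e₂ e₃ : X.Edge} (h : X.BoundsSquare e₀ e₁ e₂ e₃) :
    X.BoundsSquare e₁ e₂ e₃ e₀ := by
  obtain ⟨s, h0, h1, h2, h3⟩ := h
  exact ⟨X.rot s, h1, h2, h3, by rw [X.rot_four, h0]⟩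

theorem BoundsSquare.reverse {e₀ e₁ e₂ e₃ : X.Edge} (h : X.BoundsSquare e₀ e₁ e₂ e₃) :
    X.BoundsSquare (X.rev e₃) (X.rev e₂) (X.rev e₁) (X.rev e₀) := by
  obtain ⟨s, rfl, rfl, rfl, rfl⟩ := h
  exact ⟨X.flip s, X.first_flip s, first_rot_flip s, first_rot_rot_flip s,
    first_rot_rot_rot_flip s⟩

theorem BoundsSquare.src_eq {e₀ e₁ e₂ e₃ : X.Edge} (h : X.BoundsSquare e₀ e₁ e₂ e₃) :
    X.src e₁ = X.tgt e₀ := by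
  obtain ⟨s, rfl, rfl, rfl, rfl⟩ := h
  exact X.src_first_rot s

theorem BoundsSquare.ne_rev (hX : X.IsLocallyQuadric) {e₀ e₁ e₂ e₃ : X.Edge}
    (h : X.BoundsSquare e₀ e₁ e₂ e₃) : e₁ ≠ X.rev e₀ := by
  obtain ⟨s, rfl, rfl, rfl, rfl⟩ := h
  intro h
  apply hX.immersedCells (X.rot s)
  rw [X.first_flip, X.rot_four, h]

theorem flag_ext (hX : X.IsLocallyQuadric) {q q' : X.Flag} (h₀ : X.first q = X.first q')
    (h₁ : X.first (X.rot q) = X.first (X.rot q'))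
    (h₂ : X.first (X.rot (X.rot q)) = X.first (X.rot (X.rot q'))) : q = q' :=
  hX.no_three_edge q q' ⟨h₀, h₁, h₂⟩

/-- Two squares with two consecutive boundary edges in common are equal, or the remaining four
edges bound a square. -/
theorem BoundsSquare.glue_two (hX : X.IsLocallyQuadric) {e₀ e₁ e₂ e₃ e₂' e₃' : X.Edge}
    (h : X.BoundsSquare e₀ e₁ e₂ e₃) (h' : X.BoundsSquare e₀ e₁ e₂' e₃') :
    (e₂ = e₂' ∧ e₃ = e₃') ∨ X.BoundsSquare (X.rev e₃) (X.rev e₂) e₂' e₃' := by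
  obtain ⟨s, rfl, rfl, rfl, rfl⟩ := h
  obtain ⟨s', h0, h1, rfl, rfl⟩ := h'
  by_cases hs : s = s'
  · subst hs; exact Or.inl ⟨rfl, rfl⟩
  · right
    have := hX.replace_two s s' ⟨h0.symm, h1.symm, fun h => hs (flag_ext hX h0.symm h1.symm h),
      fun h => hs ?_⟩
    · rwa [X.first_flip, first_rot_flip] at this
    · rw [X.first_flip, X.first_flip] at h
      have h3 := rev_injective h
      have : X.rot (X.rot (X.rot s)) = X.rot (X.rot (X.rot s')) :=
        flag_ext hX h3 (by rw [X.rot_four, X.rot_four, h0]) (by rw [X.rot_four, X.rot_four, h1])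
      rw [← X.rot_four s, this, X.rot_four]

/-- Three squares around a vertex, with all three of the outer pairs of consecutive edges
reduced, can be replaced by two squares. -/
theorem BoundsSquare.glue_three (hX : X.IsLocallyQuadric) {x₁ x₂ x₃ a₁ b₁ a₂ b₂ a₃ b₃ : X.Edge}
    (h₁ : X.BoundsSquare x₁ a₁ b₁ (X.rev x₂)) (h₂ : X.BoundsSquare x₂ a₂ b₂ (X.rev x₃))
    (h₃ : X.BoundsSquare x₃ a₃ b₃ (X.rev x₁)) (i₂ : a₂ ≠ X.rev b₁) (i₃ : a₃ ≠ X.rev b₂)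
    (i₁ : a₁ ≠ X.rev b₃) :
    X.BoundsTwoSquares a₁ b₁ a₂ b₂ a₃ b₃ ∨ X.BoundsTwoSquares b₁ a₂ b₂ a₃ b₃ a₁ ∨
      X.BoundsTwoSquares a₂ b₂ a₃ b₃ a₁ b₁ := by
  obtain ⟨q₁, rfl, rfl, rfl, g₁⟩ := h₁
  obtain ⟨q₂, rfl, rfl, rfl, g₂⟩ := h₂
  obtain ⟨q₃, rfl, rfl, rfl, g₃⟩ := h₃
  refine hX.replace_three q₁ q₂ q₃ ⟨?_, ?_, ?_, ?_, ?_, ?_⟩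
  · rw [X.first_flip, g₁, X.rev_rev]
  · rw [X.first_flip, g₂, X.rev_rev]
  · rw [X.first_flip, g₃, X.rev_rev]
  · rw [first_rot_flip]; exact i₂.symm
  · rw [first_rot_flip]; exact i₃.symm
  · rw [first_rot_flip]; exact i₁.symm

/-! ### Geodesic words -/

/-- The end of the edge path from `x` which is encoded by a word: words list the edges of a path
from the last one to the first one. -/
def wordEnd (x : X.Vert) : List X.Edge → X.Vert
  | [] => x
  | e :: _ => X.tgt e

/-- The edge `e` leads from the end of the word `p` to a new vertex, as seen by a relation `R`
between words: no word related to `p` ends with the reverse of `e`. -/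
structure Ascends (x : X.Vert) (R : List X.Edge → List X.Edge → Prop) (p : List X.Edge)
    (e : X.Edge) : Prop where
  refl : R p p
  src_eq : X.src e = wordEnd x p
  not_rel : ∀ w, ¬ R p (X.rev e :: w)

/-- `GeodEq x n p p'` says that `p` and `p'` are geodesic words of length `n` from `x` which lead to
the same vertex of the universal cover. It is a partial equivalence relation, whose domain
consists of the geodesic words, and its classes are the vertices of the universal cover at
distance `n` from the base point. It is defined level by level: two edges which ascend from level
`n` have the same end when they are equal, or when they complete to a square whose fourth corner
is on level `n - 1`. -/
def GeodEq (x : X.Vert) : ℕ → List X.Edge → List X.Edge → Prop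
  | 0, p, p' => p = [] ∧ p' = []
  | n + 1, e :: p, e' :: p' => Ascends x (GeodEq x n) p e ∧ Ascends x (GeodEq x n) p' e' ∧
      ((e = e' ∧ GeodEq x n p p') ∨ ∃ c c' w, GeodEq x n p (c :: w) ∧ GeodEq x n p' (c' :: w) ∧
        X.BoundsSquare c e (X.rev e') (X.rev c'))
  | _ + 1, _, _ => False

namespace GeodEq

variable {x : X.Vert} {n m : ℕ} {e e' : X.Edge} {p p' : List X.Edge}

theorem cons_iff : GeodEq x (n + 1) (e :: p) (e' :: p') ↔
    Ascends x (GeodEq x n) p e ∧ Ascends x (GeodEq x n) p' e' ∧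
      ((e = e' ∧ GeodEq x n p p') ∨ ∃ c c' w, GeodEq x n p (c :: w) ∧ GeodEq x n p' (c' :: w) ∧
        X.BoundsSquare c e (X.rev e') (X.rev c')) := by
  rw [GeodEq]

theorem length : ∀ {n : ℕ} {p p' : List X.Edge}, GeodEq x n p p' → p.length = n ∧ p'.length = n
  | 0, p, p', h => by simp [h.1, h.2]
  | n + 1, [], _, h => by simp [GeodEq] at h
  | n + 1, _ :: _, [], h => by simp [GeodEq] at h
  | n + 1, e :: p, e' :: p', h => by
    obtain ⟨h1, h2, -⟩ := cons_iff.1 h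
    simp [(length h1.refl).1, (length h2.refl).1]

theorem level_cons (h : GeodEq x n p (e :: p')) : n = p'.length + 1 := h.length.2.symm

theorem symm : ∀ {n : ℕ} {p p' : List X.Edge}, GeodEq x n p p' → GeodEq x n p' p
  | 0, p, p', h => ⟨h.2, h.1⟩
  | n + 1, [], _, h => by simp [GeodEq] at h
  | n + 1, _ :: _, [], h => by simp [GeodEq] at h
  | n + 1, e :: p, e' :: p', h => by
    obtain ⟨h1, h2, h3⟩ := cons_iff.1 h
    refine cons_iff.2 ⟨h2, h1, ?_⟩
    rcases h3 with ⟨rfl, h3⟩ | ⟨c, c', w, hp, hp', hs⟩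
    · exact Or.inl ⟨rfl, h3.symm⟩
    · refine Or.inr ⟨c', c, w, hp', hp, ?_⟩
      have := hs.reverse
      rwa [X.rev_rev, X.rev_rev] at this

theorem _root_.SquareComplex.Ascends.geodEq (h : Ascends x (GeodEq x n) p e) :
    GeodEq x (n + 1) (e :: p) (e :: p) :=
  cons_iff.2 ⟨h, h, Or.inl ⟨rfl, h.refl⟩⟩

theorem refl_left : ∀ {n : ℕ} {p p' : List X.Edge}, GeodEq x n p p' → GeodEq x n p p
  | 0, p, p', h => ⟨h.1, h.1⟩
  | n + 1, [], _, h => by simp [GeodEq] at h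
  | n + 1, _ :: _, [], h => by simp [GeodEq] at h
  | n + 1, e :: p, e' :: p', h => (cons_iff.1 h).1.geodEq

theorem refl_right (h : GeodEq x n p p') : GeodEq x n p' p' := h.symm.refl_left

theorem ascends (h : GeodEq x (n + 1) (e :: p) p') : Ascends x (GeodEq x n) p e :=
  (cons_iff.1 h.refl_left).1

theorem wordEnd_eq : ∀ {n : ℕ} {p p' : List X.Edge}, GeodEq x n p p' → wordEnd x p = wordEnd x p'
  | 0, p, p', h => by rw [h.1, h.2]
  | n + 1, [], _, h => by simp [GeodEq] at h
  | n + 1, _ :: _, [], h => by simp [GeodEq] at h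
  | n + 1, e :: p, e' :: p', h => by
    obtain ⟨h1, h2, h3⟩ := cons_iff.1 h
    rcases h3 with ⟨rfl, h⟩ | ⟨c, c', w, hp, hp', hs⟩
    · rfl
    · exact hs.rotate.src_eq.symm

/-- Descending along a given edge is well-defined. -/
theorem cancel (hX : X.IsLocallyQuadric) (h : GeodEq x (n + 1) (e :: p) (e :: p')) :
    GeodEq x n p p' := by
  obtain ⟨h1, h2, h3⟩ := cons_iff.1 h
  rcases h3 with ⟨-, h⟩ | ⟨c, c', w, hp, hp', hs⟩
  · exact h
  · exact absurd rfl (hs.rotate.ne_rev hX)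

end GeodEq

/-- The relation `GeodEq` is transitive up to level `N`. -/
def TransUpTo (x : X.Vert) (N : ℕ) : Prop :=
  ∀ n ≤ N, ∀ a b c, GeodEq x n a b → GeodEq x n b c → GeodEq x n a c

/-- The edge `e` leads from the vertex of the universal cover given by the word `p` on level `n`
to the one given by the word `p'` on level `m`. -/
def Step (x : X.Vert) (p : List X.Edge) (n : ℕ) (e : X.Edge) (p' : List X.Edge) (m : ℕ) : Prop :=
  (m = n + 1 ∧ GeodEq x m (e :: p) p') ∨ (n = m + 1 ∧ GeodEq x n p (X.rev e :: p'))

theorem Ascends.congr {x : X.Vert} {N n : ℕ} (hT : TransUpTo x N) (hn : n ≤ N)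
    {a b : List X.Edge} {f : X.Edge} (h : Ascends x (GeodEq x n) a f) (hab : GeodEq x n a b) :
    Ascends x (GeodEq x n) b f :=
  ⟨hab.refl_right, h.src_eq.trans hab.wordEnd_eq, fun w hw => h.not_rel w (hT n hn _ _ _ hab hw)⟩

theorem Ascends.geodEq_cons {x : X.Vert} {N n : ℕ} (hT : TransUpTo x N) (hn : n ≤ N)
    {a b : List X.Edge} {f : X.Edge} (h : Ascends x (GeodEq x n) a f) (hab : GeodEq x n a b) :
    GeodEq x (n + 1) (f :: a) (f :: b) :=
  GeodEq.cons_iff.2 ⟨h, h.congr hT hn hab, Or.inl ⟨rfl, hab⟩⟩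

namespace Step

variable {x : X.Vert} {N n m m' : ℕ} {e : X.Edge} {p p' a b : List X.Edge}

theorem symm (h : Step x p n e p' m) : Step x p' m (X.rev e) p n := by
  rcases h with ⟨hm, h⟩ | ⟨hn, h⟩
  · exact Or.inr ⟨hm, by rw [X.rev_rev]; exact h.symm⟩
  · exact Or.inl ⟨hn, h.symm⟩

theorem of_rev (h : Step x p' m (X.rev e) p n) : Step x p n e p' m := by
  have := h.symm
  rwa [X.rev_rev] at this

theorem refl_left (h : Step x p n e p' m) : GeodEq x n p p := by
  rcases h with ⟨rfl, h⟩ | ⟨hn, h⟩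
  · exact h.ascends.refl
  · exact h.refl_left

theorem refl_right (h : Step x p n e p' m) : GeodEq x m p' p' := h.symm.refl_left

theorem tgt_eq (h : Step x p n e p' m) : X.tgt e = wordEnd x p' := by
  rcases h with ⟨rfl, h⟩ | ⟨rfl, h⟩
  · exact h.wordEnd_eq
  · exact h.symm.ascends.src_eq

theorem src_eq (h : Step x p n e p' m) : X.src e = wordEnd x p := by
  have := h.symm.tgt_eq
  rwa [tgt, X.rev_rev] at this

theorem unique (hX : X.IsLocallyQuadric) (hT : TransUpTo x N) (hn : n ≤ N) (hm : m ≤ N)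
    (h : Step x p n e a m) (h' : Step x p n e b m') : m = m' ∧ GeodEq x m a b := by
  rcases h with ⟨rfl, h⟩ | ⟨rfl, h⟩ <;> rcases h' with ⟨h1, h'⟩ | ⟨h1, h'⟩
  · subst h1
    exact ⟨rfl, hT _ hm _ _ _ h.symm h'⟩
  · exact absurd h' (h.ascends.not_rel b)
  · subst h1
    exact absurd h (h'.ascends.not_rel a)
  · obtain rfl : m = m' := by omega
    exact ⟨rfl, (hT _ hn _ _ _ h.symm h').cancel hX⟩

theorem exists_of_refl (h : GeodEq x n p p) (he : X.src e = wordEnd x p) :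
    ∃ p' m, Step x p n e p' m := by
  by_cases hd : ∃ w, GeodEq x n p (X.rev e :: w)
  · obtain ⟨w, hw⟩ := hd
    exact ⟨w, w.length, Or.inr ⟨hw.level_cons, hw⟩⟩
  · push Not at hd
    exact ⟨e :: p, n + 1, Or.inl ⟨rfl, Ascends.geodEq ⟨h, he, hd⟩⟩⟩

theorem level (h : Step x p n e p' m) : m = n + 1 ∨ n = m + 1 := by
  rcases h with ⟨h, -⟩ | ⟨h, -⟩
  exacts [Or.inl h, Or.inr h]

theorem congr_right (hT : TransUpTo x N) (hn : n ≤ N) (hm : m ≤ N) (h : Step x p n e a m)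
    (hab : GeodEq x m a b) : Step x p n e b m := by
  rcases h with ⟨rfl, h⟩ | ⟨rfl, h⟩
  · exact Or.inl ⟨rfl, hT _ hm _ _ _ h hab⟩
  · exact Or.inr ⟨rfl, hT _ hn _ _ _ h (h.symm.ascends.geodEq_cons hT hm hab)⟩

theorem congr_left (hT : TransUpTo x N) (hn : n ≤ N) (hm : m ≤ N) (h : Step x a n e p m)
    (hab : GeodEq x n a b) : Step x b n e p m :=
  of_rev (h.symm.congr_right hT hm hn hab)

end Step

/-- Squares lift to the levels on which `GeodEq` is known to be transitive: a lift of three sides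
of a square is closed up by the fourth side. -/
theorem Step.close_square (hX : X.IsLocallyQuadric) {x : X.Vert} {N : ℕ} (hT : TransUpTo x N) :
    ∀ (S : ℕ) {e₀ e₁ e₂ e₃ : X.Edge} {p₀ p₁ p₂ p₃ : List X.Edge} {l₀ l₁ l₂ l₃ : ℕ},
      l₀ + l₁ + l₂ + l₃ = S → l₀ ≤ N → l₁ ≤ N → l₂ ≤ N → l₃ ≤ N →
      X.BoundsSquare e₀ e₁ e₂ e₃ → Step x p₀ l₀ e₀ p₁ l₁ → Step x p₁ l₁ e₁ p₂ l₂ →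
      Step x p₂ l₂ e₂ p₃ l₃ → Step x p₃ l₃ e₃ p₀ l₀ := by
  intro S
  induction S using Nat.strong_induction_on with
  | _ S ih =>
  -- A local maximum of the level at `p₁` is pushed down by a square below `p₁`.
  have peak : ∀ {e₀ e₁ e₂ e₃ : X.Edge} {p₀ p₁ p₂ p₃ : List X.Edge} {l₀ l₁ l₂ l₃ : ℕ},
      l₀ + l₁ + l₂ + l₃ = S → l₀ ≤ N → l₁ ≤ N → l₂ ≤ N → l₃ ≤ N →
      X.BoundsSquare e₀ e₁ e₂ e₃ → Step x p₀ l₀ e₀ p₁ l₁ → Step x p₁ l₁ e₁ p₂ l₂ →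
      Step x p₂ l₂ e₂ p₃ l₃ → l₁ = l₀ + 1 → l₁ = l₂ + 1 → Step x p₃ l₃ e₃ p₀ l₀ := by
    intro e₀ e₁ e₂ e₃ p₀ p₁ p₂ p₃ l₀ l₁ l₂ l₃ hS h0 h1 h2 h3 hB s0 s1 s2 hup hdn
    subst hup
    obtain rfl : l₀ = l₂ := by omega
    have u0 : GeodEq x (l₀ + 1) (e₀ :: p₀) p₁ := by
      rcases s0 with ⟨-, h⟩ | ⟨h, -⟩
      · exact h
      · omega
    have u1 : GeodEq x (l₀ + 1) p₁ (X.rev e₁ :: p₂) := by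
      rcases s1 with ⟨h, -⟩ | ⟨-, h⟩
      · omega
      · exact h
    obtain ⟨a0, a2, ⟨he, -⟩ | ⟨c, c', w, hp, hp', hs⟩⟩ :=
      GeodEq.cons_iff.1 (hT _ h1 _ _ _ u0 u1)
    · exact absurd (by rw [he, X.rev_rev]) (hB.ne_rev hX)
    rw [X.rev_rev] at hs
    have hl : l₀ = w.length + 1 := hp.level_cons
    have d0 : Step x p₀ l₀ (X.rev c) w w.length := Or.inr ⟨hl, by rwa [X.rev_rev]⟩
    have d2 : Step x p₂ l₀ (X.rev c') w w.length := Or.inr ⟨hl, by rwa [X.rev_rev]⟩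
    rcases hB.glue_two hX hs.rotate with ⟨rfl, rfl⟩ | hB'
    · obtain ⟨rfl, hw⟩ := s2.unique hX hT h2 h3 d2
      exact Step.of_rev (d0.congr_right hT h0 (by omega) hw.symm)
    · have hB'' := hB'.reverse
      simp only [X.rev_rev] at hB''
      exact ih (l₀ + w.length + l₀ + l₃) (by omega) rfl h0 (by omega) h2 h3 hB'' d0 d2.of_rev s2
  -- A square which starts by descending is rotated, unless the definition of `GeodEq` applies.
  have descend : ∀ {e₀ e₁ e₂ e₃ : X.Edge} {p₀ p₁ p₂ p₃ : List X.Edge} {l₀ l₁ l₂ l₃ : ℕ},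
      l₀ + l₁ + l₂ + l₃ = S → l₀ ≤ N → l₁ ≤ N → l₂ ≤ N → l₃ ≤ N →
      X.BoundsSquare e₀ e₁ e₂ e₃ → Step x p₀ l₀ e₀ p₁ l₁ → Step x p₁ l₁ e₁ p₂ l₂ →
      Step x p₂ l₂ e₂ p₃ l₃ → l₀ = l₁ + 1 → l₁ = l₂ + 1 → Step x p₃ l₃ e₃ p₀ l₀ := by
    intro e₀ e₁ e₂ e₃ p₀ p₁ p₂ p₃ l₀ l₁ l₂ l₃ hS h0 h1 h2 h3 hB s0 s1 s2 hd0 hd1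
    obtain ⟨p₄, l₄, s3⟩ := Step.exists_of_refl (e := e₃) s2.refl_right
      (by rw [← s2.tgt_eq, hB.rotate.rotate.src_eq])
    have hl3 := s2.level
    have hl4 := s3.level
    by_cases hlt : l₄ < l₀
    · have s4 := ih (l₁ + l₂ + l₃ + l₄) (by omega) rfl h1 h2 h3 (by omega) hB.rotate s1 s2 s3
      obtain ⟨h, -⟩ := s4.symm.unique hX hT h1 (by omega) s0.symm
      omega
    · obtain rfl : l₀ = l₄ := by omega
      have hl : l₃ = l₁ := by omega
      subst hl
      subst hd0
      have u3 : GeodEq x (l₃ + 1) (e₃ :: p₃) p₄ := by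
        rcases s3 with ⟨-, h⟩ | ⟨h, -⟩
        · exact h
        · omega
      have u0 : GeodEq x (l₃ + 1) (X.rev e₀ :: p₁) p₀ := by
        rcases s0 with ⟨h, -⟩ | ⟨-, h⟩
        · omega
        · exact h.symm
      have u1 : GeodEq x l₃ p₁ (X.rev e₁ :: p₂) := by
        rcases s1 with ⟨h, -⟩ | ⟨-, h⟩
        · omega
        · exact h
      have u2 : GeodEq x l₃ p₃ (e₂ :: p₂) := by
        rcases s2 with ⟨-, h⟩ | ⟨h, -⟩
        · exact h.symm
        · omega
      refine Or.inl ⟨rfl, hT _ h0 _ _ _ (GeodEq.cons_iff.2 ⟨u3.ascends, u0.ascends,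
        Or.inr ⟨e₂, X.rev e₁, p₂, u2, u1, ?_⟩⟩) u0⟩
      simpa only [X.rev_rev] using hB.rotate.rotate
  intro e₀ e₁ e₂ e₃ p₀ p₁ p₂ p₃ l₀ l₁ l₂ l₃ hS h0 h1 h2 h3 hB s0 s1 s2
  have hr : X.BoundsSquare (X.rev e₂) (X.rev e₁) (X.rev e₀) (X.rev e₃) := hB.reverse.rotate
  rcases s0.level with h01 | h01 <;> rcases s1.level with h12 | h12
  · rcases s2.level with h23 | h23
    · exact (descend (by omega) h3 h2 h1 h0 hr s2.symm s1.symm s0.symm (by omega)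
        (by omega)).of_rev
    · exact (peak (by omega) h3 h2 h1 h0 hr s2.symm s1.symm s0.symm (by omega) (by omega)).of_rev
  · exact peak hS h0 h1 h2 h3 hB s0 s1 s2 h01 h12
  · rcases s2.level with h23 | h23
    · exact (descend (by omega) h3 h2 h1 h0 hr s2.symm s1.symm s0.symm (by omega)
        (by omega)).of_rev
    · exact (peak (by omega) h3 h2 h1 h0 hr s2.symm s1.symm s0.symm (by omega) (by omega)).of_rev
  · exact descend hS h0 h1 h2 h3 hB s0 s1 s2 h01 h12

end SquareComplex

namespace SquareComplex

variable {X : SquareComplex.{u}}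

/-- The essential case of transitivity: the edges `e₁`, `e₂` and `e₂`, `e₃` complete to squares with
different fourth corners `w` and `w'`, which in turn complete to a square with `p₂` and a common
lower neighbour `v`. The three squares around `p₂` are replaced by two, and each of the three
possible diagonals is treated by lifting one of the new squares. -/
theorem GeodEq.trans_of_corner (hX : X.IsLocallyQuadric) {x : X.Vert} {n : ℕ}
    (hT : TransUpTo x n) {e₁ e₂ e₃ a c b d s t : X.Edge} {p₁ p₂ p₃ w w' v : List X.Edge}
    (a₁ : Ascends x (GeodEq x n) p₁ e₁) (a₃ : Ascends x (GeodEq x n) p₃ e₃)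
    (h₁ : GeodEq x n p₁ (c :: w)) (h₂ : GeodEq x n p₂ (a :: w))
    (hs : X.BoundsSquare c e₁ (X.rev e₂) (X.rev a))
    (h₂' : GeodEq x n p₂ (b :: w')) (h₃ : GeodEq x n p₃ (d :: w'))
    (hs' : X.BoundsSquare b e₂ (X.rev e₃) (X.rev d))
    (hw : GeodEq x w.length w (s :: v)) (hw' : GeodEq x w.length w' (t :: v))
    (hv : X.BoundsSquare s a (X.rev b) (X.rev t)) :
    GeodEq x (n + 1) (e₁ :: p₁) (e₃ :: p₃) := by
  have hn : n = w.length + 1 := h₁.level_cons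
  have hnv : w.length = v.length + 1 := hw.level_cons
  have hnw : w'.length = w.length := by have := h₂'.level_cons; omega
  -- The steps of the diagram.
  have sc : Step x w w.length c p₁ n := Or.inl ⟨hn, h₁.symm⟩
  have sa : Step x w w.length a p₂ n := Or.inl ⟨hn, h₂.symm⟩
  have sb : Step x w' w.length b p₂ n := Or.inl ⟨hn, h₂'.symm⟩
  have sd : Step x w' w.length d p₃ n := Or.inl ⟨hn, h₃.symm⟩
  have ss : Step x v v.length s w w.length := Or.inl ⟨hnv, hw.symm⟩
  have st : Step x v v.length t w' w.length := Or.inl ⟨hnv, hw'.symm⟩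
  have B₁ : X.BoundsSquare (X.rev b) (X.rev t) s (X.rev (X.rev a)) := by
    rw [X.rev_rev]; exact hv.rotate.rotate
  have B₂ : X.BoundsSquare (X.rev a) c e₁ (X.rev e₂) := hs.rotate.rotate.rotate
  have B₃ : X.BoundsSquare e₂ (X.rev e₃) (X.rev d) (X.rev (X.rev b)) := by
    rw [X.rev_rev]; exact hs'.rotate
  have conclude : ∀ {c d : X.Edge} {w : List X.Edge}, GeodEq x n p₁ (c :: w) →
      GeodEq x n p₃ (d :: w) → X.BoundsSquare c e₁ (X.rev e₃) (X.rev d) →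
      GeodEq x (n + 1) (e₁ :: p₁) (e₃ :: p₃) := fun k k' k'' =>
    GeodEq.cons_iff.2 ⟨a₁, a₃, Or.inr ⟨_, _, _, k, k', k''⟩⟩
  have ic : c ≠ X.rev s := by
    rintro rfl
    obtain ⟨h, -⟩ := sc.unique hX hT (by omega) le_rfl ss.symm
    omega
  have id : X.rev t ≠ X.rev (X.rev d) := by
    intro h
    rw [X.rev_rev] at h
    subst h
    obtain ⟨h, -⟩ := sd.unique hX hT (by omega) le_rfl st.symm
    omega
  by_cases he : e₁ = e₃
  · -- The two upper squares share the edges `e₁` and `e₂`, so a square joins `p₁` to `w'`.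
    subst he
    have k := hs.reverse
    rw [X.rev_rev, X.rev_rev] at k
    -- `k : a, e₂, rev e₁, rev c`, to be compared with `b, e₂, rev e₁, rev d`.
    rcases k.rotate.glue_two hX hs'.rotate with ⟨hcd, hab⟩ | hB
    · exact absurd (by rw [hab]) (hv.rotate.ne_rev hX)
    · rw [X.rev_rev] at hB
      have s1 := Step.close_square hX hT _ rfl (by omega) le_rfl (by omega) le_rfl
        hB.rotate.rotate.rotate sb sa.symm sc
      exact GeodEq.cons_iff.2
        ⟨a₁, a₃, Or.inl ⟨rfl, (s1.of_rev.unique hX hT (by omega) le_rfl sd).2⟩⟩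
  rcases BoundsSquare.glue_three hX B₁ B₂ B₃ ic (fun h => he (rev_injective h).symm) id with
    ⟨f, q, q'⟩ | ⟨f, q, q'⟩ | ⟨f, q, q'⟩
  · -- The diagonal joins `p₁` to `w'`.
    have s1 := Step.close_square hX hT _ rfl (by omega) (by omega) (by omega) le_rfl q st.symm ss sc
    have k : GeodEq x n p₁ (X.rev f :: w') := by
      rcases s1 with ⟨h, -⟩ | ⟨-, h⟩
      · omega
      · exact h
    exact conclude k h₃ q'.rotate.rotate.rotate
  · -- The diagonal joins `v` to the common end of `e₁` and `e₃`, which contradicts their ascent.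
    obtain ⟨y, m, sy⟩ := Step.exists_of_refl (e := X.rev f) ss.refl_left
      (by rw [← ss.src_eq, q.rotate.rotate.rotate.src_eq]; rfl)
    have hm := sy.level
    have s1 := Step.close_square hX hT _ rfl (by omega) (by omega) (by omega) le_rfl
      q.rotate.rotate.rotate sy.of_rev ss sc
    rcases s1 with ⟨h, -⟩ | ⟨-, h⟩
    · omega
    · exact absurd h (a₁.not_rel y)
  · -- The diagonal joins `w` to `p₃`.
    have s1 := Step.close_square hX hT _ rfl le_rfl (by omega) (by omega) (by omega)
      q' sd.symm st.symm ss
    have k : GeodEq x n p₃ (X.rev f :: w) := by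
      rcases s1.symm with ⟨h, -⟩ | ⟨-, h⟩
      · omega
      · rwa [X.rev_rev] at h
    exact conclude h₁ k (by rwa [X.rev_rev])

/-- The relation `GeodEq` is transitive: this is where the replacement rules of locally quadric
complexes are used. -/
theorem GeodEq.trans (hX : X.IsLocallyQuadric) (x : X.Vert) (N : ℕ) : TransUpTo x N := by
  induction N with
  | zero =>
    intro n hn a b c h h'
    obtain rfl : n = 0 := by omega
    exact ⟨h.1, h'.2⟩
  | succ N ih =>
  intro n hn
  rcases Nat.lt_or_ge n (N + 1) with hlt | hge
  · exact ih n (by omega)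
  obtain rfl : n = N + 1 := by omega
  rintro (_ | ⟨e₁, p₁⟩) (_ | ⟨e₂, p₂⟩) (_ | ⟨e₃, p₃⟩) h h'
  iterate 7 exact absurd (And.intro h.length h'.length) (by simp)
  obtain ⟨a₁, a₂, r⟩ := GeodEq.cons_iff.1 h
  obtain ⟨-, a₃, r'⟩ := GeodEq.cons_iff.1 h'
  rcases r with ⟨rfl, r⟩ | ⟨c, a, w, h₁, h₂, hs⟩ <;>
    rcases r' with ⟨rfl, r'⟩ | ⟨b, d, w', h₂', h₃, hs'⟩
  · exact GeodEq.cons_iff.2 ⟨a₁, a₃, Or.inl ⟨rfl, ih N le_rfl _ _ _ r r'⟩⟩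
  · exact GeodEq.cons_iff.2 ⟨a₁, a₃, Or.inr ⟨b, d, w', ih N le_rfl _ _ _ r h₂', h₃, hs'⟩⟩
  · exact GeodEq.cons_iff.2 ⟨a₁, a₃, Or.inr ⟨c, a, w, h₁, ih N le_rfl _ _ _ r'.symm h₂, hs⟩⟩
  have hN : N = w.length + 1 := h₁.level_cons
  have key := ih N le_rfl _ _ _ h₂.symm h₂'
  have key' := key
  rw [hN] at key'
  obtain ⟨-, aw', ⟨rfl, hww⟩ | ⟨s, t, v, hw, hw', hv⟩⟩ := GeodEq.cons_iff.1 key'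
  · -- Both squares lie above the same edge `a`, from the same vertex.
    have hww' : GeodEq x N (d :: w) (d :: w') := by
      have h := h₃.refl_right
      rw [hN] at h ⊢
      exact (h.ascends.geodEq_cons ih (by omega) hww.symm).symm
    have h₃' : GeodEq x N p₃ (d :: w) := ih N le_rfl _ _ _ h₃ hww'.symm
    have k := hs.reverse
    rw [X.rev_rev, X.rev_rev] at k
    rcases k.glue_two hX hs' with ⟨he, hc⟩ | hB
    · obtain rfl := rev_injective he
      obtain rfl := rev_injective hc
      exact GeodEq.cons_iff.2 ⟨a₁, a₃, Or.inl ⟨rfl, ih N le_rfl _ _ _ h₁ h₃'.symm⟩⟩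
    · rw [X.rev_rev, X.rev_rev] at hB
      exact GeodEq.cons_iff.2 ⟨a₁, a₃, Or.inr ⟨c, d, w, h₁, h₃', hB⟩⟩
  · exact GeodEq.trans_of_corner hX ih a₁ a₃ h₁ h₂ hs h₂' h₃ hs' hw hw' hv

end SquareComplex

namespace SquareComplex

variable {X : SquareComplex.{u}}

/-! ### The universal cover as a set of homotopy classes -/

/-- A vertex, as an object of the fundamental groupoid. -/
abbrev gpdObj (X : SquareComplex.{u}) (y : X.Vert) : X.FundamentalGpd := ⟨X.obj y⟩

/-- The homotopy class of an oriented edge. -/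
def edgeClass (e : X.Edge) {a b : X.Vert} (ha : X.src e = a) (hb : X.tgt e = b) :
    X.gpdObj a ⟶ X.gpdObj b :=
  (Quotient.functor X.ElementaryHomotopy).map (X.edgePath e ha hb)

theorem src_rev (e : X.Edge) : X.src (X.rev e) = X.tgt e := rfl

theorem tgt_rev (e : X.Edge) : X.tgt (X.rev e) = X.src e := congrArg X.src (X.rev_rev e)

theorem gpd_induction {a : X.Vert} {P : ∀ b : X.Vert, (X.gpdObj a ⟶ X.gpdObj b) → Prop}
    (nil : P a (𝟙 _))
    (cons : ∀ (b : X.Vert) (γ : X.gpdObj a ⟶ X.gpdObj b) (e : X.Edge) (h : X.src e = b),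
      P b γ → P (X.tgt e) (γ ≫ edgeClass e h rfl)) (b : X.Vert) (γ : X.gpdObj a ⟶ X.gpdObj b) :
    P b γ := by
  obtain ⟨p, rfl⟩ := (Quotient.functor X.ElementaryHomotopy).map_surjective
    (X := X.obj a) (Y := X.obj b) γ
  refine Paths.induction_fixed_source (a := X.obj a)
    (P := fun {b} f => P b ((Quotient.functor X.ElementaryHomotopy).map f)) ?_ ?_ p
  · exact nil
  · rintro c d p ⟨e, hs, ht⟩ hp
    subst ht
    exact cons c _ e hs hp

theorem edgeClass_rev (e : X.Edge) {a b : X.Vert} (ha : X.src e = a) (hb : X.tgt e = b)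
    (hb' : X.src (X.rev e) = b) (ha' : X.tgt (X.rev e) = a) :
    edgeClass e ha hb ≫ edgeClass (X.rev e) hb' ha' = 𝟙 _ := by
  subst ha; subst hb
  exact CategoryTheory.Quotient.sound _ (ElementaryHomotopy.backtrack e)

theorem BoundsSquare.edgeClass_comp {e₀ e₁ e₂ e₃ : X.Edge} (h : X.BoundsSquare e₀ e₁ e₂ e₃)
    {a b c d : X.Vert} (h₀ : X.src e₀ = a) (h₀' : X.tgt e₀ = b) (h₁ : X.src e₁ = b)
    (h₁' : X.tgt e₁ = c) (h₂ : X.src e₂ = c) (h₂' : X.tgt e₂ = d) (h₃ : X.src e₃ = d)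
    (h₃' : X.tgt e₃ = a) :
    edgeClass e₀ h₀ h₀' ≫ edgeClass e₁ h₁ h₁' ≫ edgeClass e₂ h₂ h₂' ≫
      edgeClass e₃ h₃ h₃' = 𝟙 _ := by
  obtain ⟨s, rfl, rfl, rfl, rfl⟩ := h
  subst h₀; subst h₁; subst h₂; subst h₃
  exact CategoryTheory.Quotient.sound _ (ElementaryHomotopy.square s)

instance edgeClass_isIso (e : X.Edge) {a b : X.Vert} (ha : X.src e = a) (hb : X.tgt e = b) :
    IsIso (edgeClass e ha hb) := by
  have hr : ∀ f, f = X.rev (X.rev e) → ∀ (hf : X.src f = a) (hf' : X.tgt f = b),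
      edgeClass (X.rev e) ((src_rev e).trans hb) ((tgt_rev e).trans ha) ≫ edgeClass f hf hf' =
        𝟙 _ := by
    rintro _ rfl hf hf'
    exact edgeClass_rev _ _ _ _ _
  exact ⟨edgeClass (X.rev e) ((src_rev e).trans hb) ((tgt_rev e).trans ha),
    edgeClass_rev _ _ _ _ _, hr e (X.rev_rev e).symm _ _⟩

instance gpd_isIso {a b : X.Vert} (γ : X.gpdObj a ⟶ X.gpdObj b) : IsIso γ := by
  refine gpd_induction (P := fun b γ => IsIso γ) ?_ ?_ b γ
  · infer_instance
  · intro b γ e h hγ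
    infer_instance

/-- The vertices of the universal cover of `X` with base point `x`: homotopy classes of edge paths
from `x`. -/
abbrev UVert (X : SquareComplex.{u}) (x : X.Vert) : Type u := Σ y : X.Vert, X.gpdObj x ⟶ X.gpdObj y

/-- The base vertex of the universal cover. -/
def UVert.base (X : SquareComplex.{u}) (x : X.Vert) : UVert X x := ⟨x, 𝟙 _⟩

/-- The lift of the edge `e` which starts at the vertex `a` of the universal cover ends at `b`. -/
def UStep {x : X.Vert} (a : UVert X x) (e : X.Edge) (b : UVert X x) : Prop :=
  ∃ h : X.src e = a.1, b = ⟨X.tgt e, a.2 ≫ edgeClass e h rfl⟩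

namespace UStep

variable {x : X.Vert} {a b c d : UVert X x} {e : X.Edge}

theorem src_eq (h : UStep a e b) : X.src e = a.1 := h.1

theorem tgt_eq (h : UStep a e b) : X.tgt e = b.1 := by
  obtain ⟨h, rfl⟩ := h
  rfl

theorem unique (h : UStep a e b) (h' : UStep a e c) : b = c := by
  obtain ⟨h, rfl⟩ := h
  obtain ⟨h, rfl⟩ := h'
  rfl

theorem exists_of_src (a : UVert X x) (e : X.Edge) (h : X.src e = a.1) : ∃ b, UStep a e b :=
  ⟨_, h, rfl⟩

theorem iff_comp {y z : X.Vert} {γ : X.gpdObj x ⟶ X.gpdObj y} {δ : X.gpdObj x ⟶ X.gpdObj z} :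
    UStep (⟨y, γ⟩ : UVert X x) e ⟨z, δ⟩ ↔
      ∃ (h : X.src e = y) (h' : X.tgt e = z), δ = γ ≫ edgeClass e h h' := by
  constructor
  · rintro ⟨h, h'⟩
    change X.src e = y at h
    obtain rfl : z = X.tgt e := congrArg Sigma.fst h'
    exact ⟨h, rfl, eq_of_heq (Sigma.mk.inj h').2⟩
  · rintro ⟨h, rfl, rfl⟩
    exact ⟨h, rfl⟩

theorem symm (h : UStep a e b) : UStep b (X.rev e) a := by
  obtain ⟨y, γ⟩ := a
  obtain ⟨z, δ⟩ := b
  obtain ⟨rfl, rfl, rfl⟩ := iff_comp.1 h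
  refine iff_comp.2 ⟨src_rev e, tgt_rev e, ?_⟩
  rw [Category.assoc, edgeClass_rev, Category.comp_id]

theorem of_rev (h : UStep b (X.rev e) a) : UStep a e b := by
  have := h.symm
  rwa [X.rev_rev] at this

/-- Squares lift to the universal cover. -/
theorem close_square {e₀ e₁ e₂ e₃ : X.Edge} (hB : X.BoundsSquare e₀ e₁ e₂ e₃) (h₀ : UStep a e₀ b)
    (h₁ : UStep b e₁ c) (h₂ : UStep c e₂ d) : UStep d e₃ a := by
  obtain ⟨y, γ⟩ := a
  obtain ⟨z, δ⟩ := b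
  obtain ⟨y', γ'⟩ := c
  obtain ⟨z', δ'⟩ := d
  obtain ⟨rfl, rfl, rfl⟩ := iff_comp.1 h₀
  obtain ⟨k1, rfl, rfl⟩ := iff_comp.1 h₁
  obtain ⟨k2, rfl, rfl⟩ := iff_comp.1 h₂
  have k3 := hB.rotate.rotate.rotate.src_eq
  refine iff_comp.2 ⟨hB.rotate.rotate.src_eq, k3.symm, ?_⟩
  have := hB.edgeClass_comp rfl rfl k1 rfl k2 rfl hB.rotate.rotate.src_eq k3.symm
  rw [Category.assoc, Category.assoc, Category.assoc, this, Category.comp_id]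

/-- The translation by a class `γ` commutes with steps. -/
theorem translate {y : X.Vert} (γ : X.gpdObj y ⟶ X.gpdObj x) (h : UStep a e b) :
    UStep (⟨a.1, γ ≫ a.2⟩ : UVert X y) e ⟨b.1, γ ≫ b.2⟩ := by
  obtain ⟨y, γ⟩ := a
  obtain ⟨z, δ⟩ := b
  obtain ⟨rfl, rfl, rfl⟩ := iff_comp.1 h
  exact iff_comp.2 ⟨rfl, rfl, (Category.assoc _ _ _).symm⟩

end UStep

theorem UVert.induction {x : X.Vert} {P : UVert X x → Prop} (base : P (UVert.base X x))
    (step : ∀ a e b, UStep a e b → P a → P b) (a : UVert X x) : P a := by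
  obtain ⟨y, γ⟩ := a
  refine gpd_induction (P := fun y γ => P ⟨y, γ⟩) base ?_ y γ
  intro b γ e h hP
  exact step ⟨b, γ⟩ e _ ⟨h, rfl⟩ hP

/-! ### The universal cover as a set of classes of geodesic words -/

/-- The geodesic words from `x`. -/
def Geod (X : SquareComplex.{u}) (x : X.Vert) : Type u :=
  {p : List X.Edge // GeodEq x p.length p p}

theorem GeodEq.trans' (hX : X.IsLocallyQuadric) {x : X.Vert} {n : ℕ} {a b c : List X.Edge}
    (h : GeodEq x n a b) (h' : GeodEq x n b c) : GeodEq x n a c :=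
  GeodEq.trans hX x n n le_rfl _ _ _ h h'

/-- Geodesic words are equivalent when they lead to the same vertex of the universal cover. -/
def geodSetoid (hX : X.IsLocallyQuadric) (x : X.Vert) : Setoid (Geod X x) where
  r p q := GeodEq x p.1.length p.1 q.1
  iseqv := ⟨fun p => p.2, fun {p q} h => by rw [h.length.2]; exact h.symm,
    fun {p q r} h h' => h.trans' hX (by rwa [h.length.2] at h')⟩

/-- The model of the universal cover made of the classes of geodesic words. -/
def GVert (hX : X.IsLocallyQuadric) (x : X.Vert) : Type u := _root_.Quotient (geodSetoid hX x)

section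

variable {hX : X.IsLocallyQuadric} {x : X.Vert}

/-- The distance of a vertex of the model from the base vertex. -/
def GVert.level (a : GVert hX x) : ℕ :=
  _root_.Quotient.lift (fun p : Geod X x => p.1.length) (fun _ _ h => (GeodEq.length h).2.symm) a

/-- The image in `X` of a vertex of the model. -/
def GVert.pt (a : GVert hX x) : X.Vert :=
  _root_.Quotient.lift (fun p : Geod X x => wordEnd x p.1) (fun _ _ h => GeodEq.wordEnd_eq h) a

/-- The class of a geodesic word. -/
def GVert.mk (hX : X.IsLocallyQuadric) (p : Geod X x) : GVert hX x := Quotient.mk'' p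

/-- The base vertex of the model. -/
def GVert.base (hX : X.IsLocallyQuadric) (x : X.Vert) : GVert hX x := GVert.mk hX ⟨[], rfl, rfl⟩

theorem GVert.mk_eq {p q : Geod X x} :
    GVert.mk hX p = GVert.mk hX q ↔ GeodEq x p.1.length p.1 q.1 :=
  _root_.Quotient.eq (r := geodSetoid hX x)

theorem GVert.exists_mk (a : GVert hX x) : ∃ p, GVert.mk hX p = a :=
  _root_.Quotient.exists_rep a

/-- The lift of the edge `e` which starts at the vertex `a` of the model ends at `b`. -/
def GStep (a : GVert hX x) (e : X.Edge) (b : GVert hX x) : Prop :=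
  ∃ p q : Geod X x, GVert.mk hX p = a ∧ GVert.mk hX q = b ∧ Step x p.1 p.1.length e q.1 q.1.length

namespace GStep

variable {a b c d : GVert hX x} {e f : X.Edge}

theorem iff_step {p q : Geod X x} :
    GStep (GVert.mk hX p) e (GVert.mk hX q) ↔ Step x p.1 p.1.length e q.1 q.1.length := by
  refine ⟨?_, fun h => ⟨p, q, rfl, rfl, h⟩⟩
  rintro ⟨p', q', hp, hq, h⟩
  rw [GVert.mk_eq] at hp hq
  have hp' := hp.length.2
  have hq' := hq.length.2
  have hT := GeodEq.trans hX x (p.1.length + q.1.length)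
  rw [← hp', ← hq'] at h
  rw [← hp'] at hp
  rw [← hq'] at hq
  exact (h.congr_left hT (by omega) (by omega) hp).congr_right hT (by omega) (by omega) hq

theorem symm (h : GStep a e b) : GStep b (X.rev e) a := by
  obtain ⟨p, q, rfl, rfl, h⟩ := h
  exact ⟨q, p, rfl, rfl, h.symm⟩

theorem src_eq (h : GStep a e b) : X.src e = a.pt := by
  obtain ⟨p, q, rfl, rfl, h⟩ := h
  exact h.src_eq

theorem tgt_eq (h : GStep a e b) : X.tgt e = b.pt := by
  obtain ⟨p, q, rfl, rfl, h⟩ := h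
  exact h.tgt_eq

theorem level (h : GStep a e b) : b.level = a.level + 1 ∨ a.level = b.level + 1 := by
  obtain ⟨p, q, rfl, rfl, h⟩ := h
  exact h.level

theorem unique (h : GStep a e b) (h' : GStep a e c) : b = c := by
  obtain ⟨p, rfl⟩ := a.exists_mk
  obtain ⟨q, rfl⟩ := b.exists_mk
  obtain ⟨r, rfl⟩ := c.exists_mk
  rw [iff_step] at h h'
  exact GVert.mk_eq.2 (h.unique hX (GeodEq.trans hX x (p.1.length + q.1.length)) (by omega)
    (by omega) h').2

theorem exists_of_src (a : GVert hX x) (e : X.Edge) (he : X.src e = a.pt) : ∃ b, GStep a e b := by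
  obtain ⟨p, rfl⟩ := a.exists_mk
  obtain ⟨q, m, h⟩ := Step.exists_of_refl p.2 he
  have hm : q.length = m := h.refl_right.length.1
  subst hm
  exact ⟨GVert.mk hX ⟨q, h.refl_right⟩, iff_step.2 h⟩

theorem close_square {e₀ e₁ e₂ e₃ : X.Edge} (hB : X.BoundsSquare e₀ e₁ e₂ e₃) (h₀ : GStep a e₀ b)
    (h₁ : GStep b e₁ c) (h₂ : GStep c e₂ d) : GStep d e₃ a := by
  obtain ⟨p, rfl⟩ := a.exists_mk
  obtain ⟨q, rfl⟩ := b.exists_mk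
  obtain ⟨r, rfl⟩ := c.exists_mk
  obtain ⟨s, rfl⟩ := d.exists_mk
  rw [iff_step] at h₀ h₁ h₂ ⊢
  exact Step.close_square hX
    (GeodEq.trans hX x (p.1.length + q.1.length + r.1.length + s.1.length)) _ rfl (by omega)
    (by omega) (by omega) (by omega) hB h₀ h₁ h₂

theorem exists_descent (a : GVert hX x) (ha : a.level ≠ 0) :
    ∃ e b, GStep a e b ∧ a.level = b.level + 1 := by
  obtain ⟨⟨_ | ⟨e, p⟩, hp⟩, rfl⟩ := a.exists_mk
  · exact absurd rfl ha
  · refine ⟨X.rev e, GVert.mk hX ⟨p, GeodEq.ascends hp |>.refl⟩, iff_step.2 (Or.inr ⟨rfl, ?_⟩), rfl⟩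
    rw [X.rev_rev]
    exact hp

/-- Two edges which descend from the same vertex span a square. -/
theorem quadrangle (h : GStep a e b) (h' : GStep a f c) (hb : a.level = b.level + 1)
    (hc : a.level = c.level + 1) (hef : e ≠ f) :
    ∃ g k d, GStep b g d ∧ GStep c k d ∧ X.BoundsSquare e g (X.rev k) (X.rev f) ∧
      b.level = d.level + 1 := by
  obtain ⟨p, rfl⟩ := a.exists_mk
  obtain ⟨q, rfl⟩ := b.exists_mk
  obtain ⟨r, rfl⟩ := c.exists_mk
  rw [iff_step] at h h'
  change p.1.length = q.1.length + 1 at hb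
  change p.1.length = r.1.length + 1 at hc
  have u : GeodEq x p.1.length p.1 (X.rev e :: q.1) := by
    rcases h with ⟨h, -⟩ | ⟨-, h⟩
    · omega
    · exact h
  have u' : GeodEq x p.1.length p.1 (X.rev f :: r.1) := by
    rcases h' with ⟨h, -⟩ | ⟨-, h⟩
    · omega
    · exact h
  have k := u.symm.trans' hX u'
  rw [hb] at k
  obtain ⟨-, -, ⟨he, -⟩ | ⟨s, t, v, hs, ht, hv⟩⟩ := GeodEq.cons_iff.1 k
  · exact absurd (rev_injective he) hef
  have hv' := GeodEq.refl_right hs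
  have hl := hs.level_cons
  rw [hl] at hv'
  refine ⟨X.rev s, X.rev t, GVert.mk hX ⟨v, hv'.ascends.refl⟩, iff_step.2 (Or.inr ⟨hl, ?_⟩),
    iff_step.2 (Or.inr ⟨by change r.1.length = v.length + 1; omega, ?_⟩), ?_, hl⟩
  · rwa [X.rev_rev]
  · rw [X.rev_rev]
    rwa [show r.1.length = q.1.length by omega]
  · have := hv.reverse.rotate.rotate
    simpa only [X.rev_rev] using this

end GStep

end

end SquareComplex

namespace SquareComplex

variable {X : SquareComplex.{u}}

/-! ### Monodromy -/

section

variable (hX : X.IsLocallyQuadric) {x : X.Vert}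

/-- The vertices of the model over a vertex of `X`. -/
def Fibre (x y : X.Vert) : Type u := {c : GVert hX x // c.pt = y}

/-- The end of the lift of an edge, as a function of the start. -/
noncomputable def Fibre.move {a b : X.Vert} (e : X.Edge) (ha : X.src e = a) (hb : X.tgt e = b)
    (c : Fibre hX x a) : Fibre hX x b :=
  ⟨(GStep.exists_of_src c.1 e (ha.trans c.2.symm)).choose,
    (GStep.exists_of_src c.1 e (ha.trans c.2.symm)).choose_spec.tgt_eq.symm.trans hb⟩

theorem Fibre.gStep_move {a b : X.Vert} (e : X.Edge) (ha : X.src e = a) (hb : X.tgt e = b)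
    (c : Fibre hX x a) : GStep c.1 e (Fibre.move hX e ha hb c).1 :=
  (GStep.exists_of_src c.1 e (ha.trans c.2.symm)).choose_spec

/-- The action of edges on the fibres of the model. -/
noncomputable def fibrePrefunctor (x : X.Vert) : X.OneSkeleton ⥤q Type u where
  obj y := Fibre hX x y
  map e := TypeCat.ofHom (Fibre.move hX e.1 e.2.1 e.2.2)

theorem lift_fibrePrefunctor_eq {a b : Paths X.OneSkeleton} {f g : a ⟶ b}
    (h : X.ElementaryHomotopy f g) : (Paths.lift (fibrePrefunctor hX x)).map f =
      (Paths.lift (fibrePrefunctor hX x)).map g := by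
  cases h with
  | backtrack e =>
    refine ConcreteCategory.hom_ext _ _ fun (c : Fibre hX x (X.src e)) => Subtype.ext ?_
    have h₁ := Fibre.gStep_move hX e rfl rfl c
    have h₂ := Fibre.gStep_move hX (X.rev e) rfl (tgt_rev e) (Fibre.move hX e rfl rfl c)
    exact h₂.unique h₁.symm
  | square q =>
    refine ConcreteCategory.hom_ext _ _ fun (c : Fibre hX x (X.base q)) => Subtype.ext ?_
    let m (q : X.Flag) := Fibre.move (x := x) hX (X.first q) rfl (X.src_first_rot q).symm
    have hm (q : X.Flag) := Fibre.gStep_move (x := x) hX (X.first q) rfl (X.src_first_rot q).symm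
    have h₁ := hm q c
    have h₂ := hm (X.rot q) (m q c)
    have h₃ := hm (X.rot (X.rot q)) (m (X.rot q) (m q c))
    have h₄ := Fibre.gStep_move hX (X.first (X.rot (X.rot (X.rot q)))) rfl
      ((X.src_first_rot _).symm.trans (by rw [X.rot_four]))
      (m (X.rot (X.rot q)) (m (X.rot q) (m q c)))
    exact h₄.unique (GStep.close_square ⟨q, rfl, rfl, rfl, rfl⟩ h₁ h₂ h₃)

/-- The monodromy action of the fundamental groupoid on the fibres of the model. -/
noncomputable def monodromy (x : X.Vert) : X.FundamentalGpd ⥤ Type u :=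
  CategoryTheory.Quotient.lift _ (Paths.lift (fibrePrefunctor hX x))
    fun _ _ _ _ h => lift_fibrePrefunctor_eq hX h

/-- The vertex of the model to which a homotopy class of paths leads. -/
noncomputable def UVert.toG (a : UVert X x) : GVert hX x :=
  ((monodromy hX x).map a.2 (⟨GVert.base hX x, rfl⟩ : Fibre hX x x) : Fibre hX x a.1).1

theorem UVert.toG_base : (UVert.base X x).toG hX = GVert.base hX x := by
  unfold UVert.toG UVert.base
  rw [CategoryTheory.Functor.map_id]
  rfl

theorem UVert.pt_toG (a : UVert X x) : (a.toG hX).pt = a.1 :=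
  ((monodromy hX x).map a.2 (⟨GVert.base hX x, rfl⟩ : Fibre hX x x) : Fibre hX x a.1).2

theorem UStep.toG {a b : UVert X x} {e : X.Edge} (h : UStep a e b) :
    GStep (a.toG hX) e (b.toG hX) := by
  obtain ⟨y, γ⟩ := a
  obtain ⟨z, δ⟩ := b
  obtain ⟨rfl, rfl, rfl⟩ := UStep.iff_comp.1 h
  have := Fibre.gStep_move hX e rfl rfl ((monodromy hX x).map γ
    (⟨GVert.base hX x, rfl⟩ : Fibre hX x x) : Fibre hX x (X.src e))
  have h2 : (monodromy hX x).map (γ ≫ edgeClass e rfl rfl) (⟨GVert.base hX x, rfl⟩ : Fibre hX x x) =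
      Fibre.move hX e rfl rfl ((monodromy hX x).map γ
    (⟨GVert.base hX x, rfl⟩ : Fibre hX x x) : Fibre hX x (X.src e)) := by
    rw [Functor.map_comp]
    rfl
  unfold UVert.toG
  rw [h2]
  exact this

end

open Classical in
/-- The end in the universal cover of the path encoded by a word. Edges which do not continue the
path are ignored. -/
noncomputable def wordVert (x : X.Vert) : List X.Edge → UVert X x
  | [] => UVert.base X x
  | e :: p => if h : X.src e = (wordVert x p).1 then
      ⟨X.tgt e, (wordVert x p).2 ≫ edgeClass e h rfl⟩ else wordVert x p

theorem wordVert_cons {x : X.Vert} {p : List X.Edge} {e : X.Edge}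
    (h : X.src e = (wordVert x p).1) : UStep (wordVert x p) e (wordVert x (e :: p)) := by
  refine ⟨h, ?_⟩
  rw [wordVert, dif_pos h]

theorem wordVert_fst {x : X.Vert} : ∀ {n : ℕ} {p : List X.Edge}, GeodEq x n p p →
    (wordVert x p).1 = wordEnd x p
  | 0, p, h => by rw [h.1]; rfl
  | n + 1, [], h => by simp [GeodEq] at h
  | n + 1, e :: p, h => by
    have := wordVert_fst h.ascends.refl
    have := wordVert_cons (h.ascends.src_eq.trans this.symm)
    exact this.tgt_eq.symm

theorem GeodEq.uStep {x : X.Vert} {n : ℕ} {e : X.Edge} {p p' : List X.Edge}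
    (h : GeodEq x (n + 1) (e :: p) p') : UStep (wordVert x p) e (wordVert x (e :: p)) :=
  wordVert_cons (h.ascends.src_eq.trans (wordVert_fst h.ascends.refl).symm)

theorem GeodEq.wordVert_eq {x : X.Vert} : ∀ {n : ℕ} {p p' : List X.Edge}, GeodEq x n p p' →
    wordVert x p = wordVert x p'
  | 0, p, p', h => by rw [h.1, h.2]
  | n + 1, [], _, h => by simp [GeodEq] at h
  | n + 1, _ :: _, [], h => by simp [GeodEq] at h
  | n + 1, e :: p, e' :: p', h => by
    obtain ⟨h₁, h₂, h₃⟩ := cons_iff.1 h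
    have s := h.uStep
    have s' := h.symm.uStep
    rcases h₃ with ⟨rfl, h₃⟩ | ⟨c, c', w, hp, hp', hs⟩
    · rw [h₃.wordVert_eq] at s
      exact s.unique s'
    · rw [hp.wordVert_eq] at s
      rw [hp'.wordVert_eq] at s'
      have hl := hp.level_cons
      subst hl
      have t := UStep.close_square hs.rotate.rotate.rotate hp'.symm.uStep.symm
        hp.symm.uStep s
      exact t.of_rev.unique s'

variable {hX : X.IsLocallyQuadric} {x : X.Vert}

/-- The homotopy class of paths which lead to a vertex of the model. -/
noncomputable def GVert.toU (a : GVert hX x) : UVert X x :=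
  _root_.Quotient.lift (fun p : Geod X x => wordVert x p.1) (fun _ _ h => GeodEq.wordVert_eq h) a

theorem GStep.toU {a b : GVert hX x} {e : X.Edge} (h : GStep a e b) : UStep a.toU e b.toU := by
  obtain ⟨p, q, rfl, rfl, ⟨hl, h⟩ | ⟨hl, h⟩⟩ := h
  · rw [hl] at h
    have := h.uStep
    rw [h.wordVert_eq] at this
    exact this
  · rw [hl] at h
    have := h.symm.uStep
    rw [h.symm.wordVert_eq] at this
    exact this.of_rev

/-- The two models of the universal cover agree: homotopy classes are detected by geodesic words. -/
theorem UVert.toU_toG (a : UVert X x) : (a.toG hX).toU = a := by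
  induction a using UVert.induction with
  | base => rw [UVert.toG_base]; rfl
  | step a e b h ih =>
    have := (h.toG hX).toU
    rw [ih] at this
    exact this.unique h

/-! ### The metric of the universal cover -/

/-- The distance from `a` to `b` in the universal cover, given as the level of `b` in the model
based at `a`. -/
noncomputable def coverDist (hX : X.IsLocallyQuadric) (a b : UVert X x) : ℕ :=
  (UVert.toG hX (⟨b.1, inv a.2 ≫ b.2⟩ : UVert X a.1)).level

theorem translate_injective {y : X.Vert} (γ : X.gpdObj y ⟶ X.gpdObj x) :
    Function.Injective fun b : UVert X x => (⟨b.1, γ ≫ b.2⟩ : UVert X y) := by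
  rintro ⟨b, β⟩ ⟨c, δ⟩ h
  obtain rfl : b = c := congrArg Sigma.fst h
  have := eq_of_heq (Sigma.mk.inj h).2
  rw [cancel_epi] at this
  exact congrArg (Sigma.mk b) this

theorem coverDist_eq_zero {a b : UVert X x} : coverDist hX a b = 0 ↔ a = b := by
  constructor
  · intro h
    apply translate_injective (inv a.2)
    change (⟨a.1, inv a.2 ≫ a.2⟩ : UVert X a.1) = ⟨b.1, inv a.2 ≫ b.2⟩
    rw [IsIso.inv_hom_id, ← UVert.toU_toG (hX := hX) ⟨b.1, _⟩]
    obtain ⟨⟨p, hp⟩, h'⟩ := GVert.exists_mk (UVert.toG hX (⟨b.1, inv a.2 ≫ b.2⟩ : UVert X a.1))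
    rw [coverDist, ← h'] at h
    obtain rfl : p = [] := List.eq_nil_of_length_eq_zero h
    rw [← h']
    rfl
  · rintro rfl
    rw [coverDist, IsIso.inv_hom_id]
    exact congrArg GVert.level (UVert.toG_base hX)

theorem UStep.coverDist_eq {a b c : UVert X x} {e : X.Edge} (h : UStep b e c) :
    coverDist hX a c = coverDist hX a b + 1 ∨ coverDist hX a b = coverDist hX a c + 1 :=
  ((h.translate (inv a.2)).toG hX).level

/-- A step in the model based at `a` comes from a step in the universal cover. -/
theorem uStep_of_gStep {a b : UVert X x} {e : X.Edge} {g : GVert hX a.1}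
    (h : GStep (UVert.toG hX (⟨b.1, inv a.2 ≫ b.2⟩ : UVert X a.1)) e g) :
    ∃ c, UStep b e c ∧ UVert.toG hX (⟨c.1, inv a.2 ≫ c.2⟩ : UVert X a.1) = g := by
  have hs : X.src e = b.1 := h.src_eq.trans (UVert.pt_toG hX _)
  obtain ⟨c, hc⟩ := UStep.exists_of_src b e hs
  exact ⟨c, hc, ((hc.translate (inv a.2)).toG hX).unique h⟩

theorem exists_descent {a b : UVert X x} (h : a ≠ b) :
    ∃ e c, UStep b e c ∧ coverDist hX a b = coverDist hX a c + 1 := by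
  obtain ⟨e, g, hg, hl⟩ := GStep.exists_descent _ (fun h' => h (coverDist_eq_zero (hX := hX).1 h'))
  obtain ⟨c, hc, rfl⟩ := uStep_of_gStep hg
  exact ⟨e, c, hc, hl⟩

theorem quadrangle {o a b c : UVert X x} {e f : X.Edge} (h : UStep a e b) (h' : UStep a f c)
    (hb : coverDist hX o a = coverDist hX o b + 1) (hc : coverDist hX o a = coverDist hX o c + 1)
    (hef : e ≠ f) :
    ∃ g k d, UStep b g d ∧ UStep c k d ∧ X.BoundsSquare e g (X.rev k) (X.rev f) ∧
      coverDist hX o b = coverDist hX o d + 1 := by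
  obtain ⟨g, k, d, hd, hd', hs, hl⟩ := GStep.quadrangle ((h.translate (inv o.2)).toG hX)
    ((h'.translate (inv o.2)).toG hX) hb hc hef
  obtain ⟨d', h₁, rfl⟩ := uStep_of_gStep hd
  refine ⟨g, k, d', h₁, ?_, hs, hl⟩
  exact (UStep.close_square hs.rotate.rotate.rotate h'.symm h h₁).of_rev

/-- The 1-skeleton of the universal cover has no multiple edges. -/
theorem UStep.edge_unique (hX : X.IsLocallyQuadric) {a b : UVert X x} {e f : X.Edge}
    (h : UStep a e b) (h' : UStep a f b) : e = f := by
  by_contra hef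
  have key : ∀ (n : ℕ) {a b : UVert X x} {e f : X.Edge}, coverDist hX (UVert.base X x) b = n →
      UStep a e b → UStep a f b → e ≠ f → coverDist hX (UVert.base X x) a = n + 1 → False := by
    intro n
    induction n with
    | zero =>
      intro a b e f hb h h' hef ha
      obtain ⟨g, k, d, hd, hd', hs, hl⟩ := quadrangle (hX := hX) (o := UVert.base X x)
        h h' (by omega) (by omega) hef
      omega
    | succ n ih =>
      intro a b e f hb h h' hef ha
      obtain ⟨g, k, d, hd, hd', hs, hl⟩ := quadrangle (hX := hX) (o := UVert.base X x)
        h h' (by omega) (by omega) hef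
      refine ih (by omega) hd hd' ?_ (by omega)
      rintro rfl
      exact hs.rotate.ne_rev hX rfl
  rcases h.coverDist_eq (hX := hX) (a := UVert.base X x) with hl | hl
  · exact key _ rfl h.symm h'.symm (fun h => hef (rev_injective h)) hl
  · exact key _ rfl h h' hef hl

end SquareComplex

namespace SimpleGraph

/-! ### Invariant bicliques in quadric graphs -/

/-- The graphs which occur as 1-skeleta of simply connected locally quadric complexes: connected
bipartite graphs such that two neighbours of `a` which are closer than `a` to a vertex `o` have a
common neighbour which is even closer to `o`, and such that every 6-cycle spanned by three 4-cycles
around a vertex has a long diagonal. -/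
structure IsQuadric {V : Type u} (G : SimpleGraph V) : Prop where
  connected : G.Connected
  dist_ne : ∀ o a b, G.Adj a b → G.dist o a ≠ G.dist o b
  quadrangle : ∀ o a b c, G.Adj a b → G.Adj a c → b ≠ c → G.dist o a = G.dist o b + 1 →
    G.dist o a = G.dist o c + 1 → ∃ d, G.Adj b d ∧ G.Adj c d ∧ G.dist o b = G.dist o d + 1
  hexagon : ∀ v a₁ a₂ a₃ p₁ p₂ p₃, G.Adj v a₁ → G.Adj v a₂ → G.Adj v a₃ → a₁ ≠ a₂ → a₂ ≠ a₃ →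
    a₃ ≠ a₁ → v ≠ p₁ → v ≠ p₂ → v ≠ p₃ → p₁ ≠ p₂ → p₂ ≠ p₃ → p₃ ≠ p₁ →
    G.Adj a₂ p₁ → G.Adj a₃ p₁ → G.Adj a₃ p₂ → G.Adj a₁ p₂ → G.Adj a₁ p₃ → G.Adj a₂ p₃ →
    G.Adj a₁ p₁ ∨ G.Adj a₂ p₂ ∨ G.Adj a₃ p₃

variable {V : Type u} {G : SimpleGraph V}

theorem Connected.exists_adj_closer (hG : G.Connected) {o a : V} (h : a ≠ o) :
    ∃ b, G.Adj a b ∧ G.dist o a = G.dist o b + 1 := by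
  obtain ⟨p, hp⟩ := hG.exists_walk_length_eq_dist a o
  cases p with
  | nil => exact absurd rfl h
  | @cons _ b _ hab p =>
    refine ⟨b, hab, ?_⟩
    rw [Walk.length_cons] at hp
    have h₁ := dist_le p
    have h₂ := hG.dist_triangle (u := a) (v := b) (w := o)
    rw [dist_eq_one_iff_adj.2 hab] at h₂
    rw [dist_comm (u := o), dist_comm (u := o)]
    omega

theorem Connected.dist_le_of_adj (hG : G.Connected) {a b : V} (h : G.Adj a b) (o : V) :
    G.dist o b ≤ G.dist o a + 1 := by
  have := hG.dist_triangle (u := o) (v := a) (w := b)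
  rwa [dist_eq_one_iff_adj.2 h] at this

namespace IsQuadric




theorem dist_adj (hG : G.IsQuadric) {a b : V} (h : G.Adj a b) (o : V) :
    G.dist o b = G.dist o a + 1 ∨ G.dist o a = G.dist o b + 1 := by
  have h₁ := hG.connected.dist_le_of_adj h o
  have h₂ := hG.connected.dist_le_of_adj h.symm o
  have h₃ := hG.dist_ne o a b h
  omega

/-- Some geodesic from `x` to `y` starts by approaching `v`, unless `x` lies between `v` and `y`. -/
theorem exists_approach (hG : G.IsQuadric) (v y : V) : ∀ (n : ℕ) (x : V), G.dist y x = n → x ≠ y →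
    (∃ x', G.Adj x x' ∧ G.dist y x = G.dist y x' + 1 ∧ G.dist v x = G.dist v x' + 1) ∨
      G.dist v y = G.dist v x + G.dist y x := by
  intro n
  induction n with
  | zero =>
    intro x h hxy
    exact absurd (hG.connected.dist_eq_zero_iff.1 h).symm hxy
  | succ n ih =>
    intro x h hxy
    obtain ⟨x', ha, hd⟩ := hG.connected.exists_adj_closer hxy
    rcases hG.dist_adj ha v with hv | hv
    · by_cases hy : x' = y
      · subst hy
        have : G.dist x' x' = 0 := dist_self
        omega
      rcases ih x' (by omega) hy with ⟨x'', ha', hd', hv'⟩ | h'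
      · by_cases hx : x = x''
        · subst hx
          omega
        -- The peak `x, x', x''` is replaced by a path through a vertex closer to `v`.
        obtain ⟨z, hz, hz', hvz⟩ := hG.quadrangle v x' x x'' ha.symm ha' hx hv hv'
        refine Or.inl ⟨z, hz, ?_, hvz⟩
        have h₁ := hG.connected.dist_le_of_adj hz' y
        have h₂ := hG.connected.dist_le_of_adj hz.symm y
        omega
      · right
        omega
    · exact Or.inl ⟨x', ha, hd, hv⟩

/-- If `v` does not lie between `x` and `y`, then some neighbour of `v` is closer to both. -/
theorem exists_adj_closer_pair (hG : G.IsQuadric) (v : V) : ∀ (n : ℕ) (x y : V), G.dist y x = n →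
    G.dist y x < G.dist v x + G.dist v y →
    ∃ b, G.Adj v b ∧ G.dist x v = G.dist x b + 1 ∧ G.dist y v = G.dist y b + 1 := by
  intro n
  induction n with
  | zero =>
    intro x y h hlt
    obtain rfl := hG.connected.dist_eq_zero_iff.1 h
    have hv : v ≠ y := by
      rintro rfl
      simp at hlt
    obtain ⟨b, hb, hd⟩ := hG.connected.exists_adj_closer hv
    exact ⟨b, hb, hd, hd⟩
  | succ n ih =>
    intro x y h hlt
    have hxy : x ≠ y := by
      rintro rfl
      simp at h
    rcases hG.exists_approach v y _ x rfl hxy with ⟨x', ha, hd, hv⟩ | h'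
    · obtain ⟨b, hb, hx', hy⟩ := ih x' y (by omega) (by omega)
      refine ⟨b, hb, ?_, hy⟩
      have h₁ := hG.connected.dist_le_of_adj ha.symm b
      have h₂ := hG.connected.dist_le_of_adj hb.symm x
      have h₃ : G.dist x v = G.dist v x := dist_comm
      have h₄ : G.dist x' v = G.dist v x' := dist_comm
      have h₅ : G.dist x b = G.dist b x := dist_comm
      have h₆ : G.dist x' b = G.dist b x' := dist_comm
      omega
    · have hvx : v ≠ x := by
        rintro rfl
        rw [dist_self] at h' hlt
        omega
      obtain ⟨b, hb, hd⟩ := hG.connected.exists_adj_closer hvx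
      refine ⟨b, hb, hd, ?_⟩
      have h₁ := hG.connected.dist_triangle (u := b) (v := x) (w := y)
      have h₂ := hG.connected.dist_le_of_adj hb.symm y
      have h₃ : G.dist x v = G.dist v x := dist_comm
      have h₄ : G.dist y v = G.dist v y := dist_comm
      have h₅ : G.dist x b = G.dist b x := dist_comm
      have h₆ : G.dist y b = G.dist b y := dist_comm
      have h₇ : G.dist y x = G.dist x y := dist_comm
      omega

/-- The Helly property for finite families: pairwise meeting sets of neighbours of `v` which are
closer to a given vertex have a common element. -/
theorem exists_adj_closer_finset (hG : G.IsQuadric) (v : V) : ∀ (n : ℕ) (T : Finset V), T.card = n →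
    T.Nonempty → (∀ x ∈ T, ∀ y ∈ T, G.dist y x < G.dist v x + G.dist v y) →
    ∃ b, G.Adj v b ∧ ∀ x ∈ T, G.dist x v = G.dist x b + 1 := by
  classical
  intro n
  induction n with
  | zero =>
    intro T hT hne
    exact absurd (Finset.card_eq_zero.1 hT) hne.ne_empty
  | succ n ih =>
  intro T hT hne hlt
  rcases Nat.lt_or_ge 2 T.card with h2 | h2
  · obtain ⟨x₁, h₁, x₂, h₂, x₃, h₃, h₁₂, h₁₃, h₂₃⟩ := Finset.two_lt_card.1 h2
    -- All but one of the conditions can be satisfied, by induction.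
    have key : ∀ x ∈ T, ∃ b, G.Adj v b ∧ ∀ y ∈ T, y ≠ x → G.dist y v = G.dist y b + 1 := by
      intro x hx
      have hc := Finset.card_erase_of_mem hx
      obtain ⟨b, hb, hb'⟩ := ih (T.erase x) (by omega) (Finset.card_pos.1 (by omega))
        fun y hy z hz => hlt y (Finset.mem_of_mem_erase hy) z (Finset.mem_of_mem_erase hz)
      exact ⟨b, hb, fun y hy hyx => hb' y (Finset.mem_erase.2 ⟨hyx, hy⟩)⟩
    obtain ⟨a₁, ha₁, k₁⟩ := key x₁ h₁
    obtain ⟨a₂, ha₂, k₂⟩ := key x₂ h₂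
    obtain ⟨a₃, ha₃, k₃⟩ := key x₃ h₃
    by_contra hcon
    have bad : ∀ {x a : V}, G.Adj v a → (∀ y ∈ T, y ≠ x → G.dist y v = G.dist y a + 1) →
        G.dist x v ≠ G.dist x a + 1 := by
      intro x a ha k h
      refine hcon ⟨a, ha, fun y hy => ?_⟩
      by_cases hyx : y = x
      · rwa [hyx]
      · exact k y hy hyx
    have b₁ := bad ha₁ k₁
    have b₂ := bad ha₂ k₂
    have b₃ := bad ha₃ k₃
    have k₁₂ := k₁ x₂ h₂ h₁₂.symm
    have k₁₃ := k₁ x₃ h₃ h₁₃.symm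
    have k₂₁ := k₂ x₁ h₁ h₁₂
    have k₂₃ := k₂ x₃ h₃ h₂₃.symm
    have k₃₁ := k₃ x₁ h₁ h₁₃
    have k₃₂ := k₃ x₂ h₂ h₂₃
    have n₁₂ : a₁ ≠ a₂ := by rintro rfl; exact b₁ k₂₁
    have n₂₃ : a₂ ≠ a₃ := by rintro rfl; exact b₂ k₃₂
    have n₃₁ : a₃ ≠ a₁ := by rintro rfl; exact b₁ k₃₁
    obtain ⟨p₁, hp₁, hp₁', d₁⟩ := hG.quadrangle x₁ v a₂ a₃ ha₂ ha₃ n₂₃ k₂₁ k₃₁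
    obtain ⟨p₂, hp₂, hp₂', d₂⟩ := hG.quadrangle x₂ v a₃ a₁ ha₃ ha₁ n₃₁ k₃₂ k₁₂
    obtain ⟨p₃, hp₃, hp₃', d₃⟩ := hG.quadrangle x₃ v a₁ a₂ ha₁ ha₂ n₁₂ k₁₃ k₂₃
    have c₁ : ¬ G.Adj a₁ p₁ := fun h => by
      have := hG.connected.dist_le_of_adj h.symm x₁
      have := hG.dist_adj ha₁ x₁
      omega
    have c₂ : ¬ G.Adj a₂ p₂ := fun h => by
      have := hG.connected.dist_le_of_adj h.symm x₂
      have := hG.dist_adj ha₂ x₂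
      omega
    have c₃ : ¬ G.Adj a₃ p₃ := fun h => by
      have := hG.connected.dist_le_of_adj h.symm x₃
      have := hG.dist_adj ha₃ x₃
      omega
    rcases hG.hexagon v a₁ a₂ a₃ p₁ p₂ p₃ ha₁ ha₂ ha₃ n₁₂ n₂₃ n₃₁ (by rintro rfl; omega)
      (by rintro rfl; omega) (by rintro rfl; omega) (by rintro rfl; exact c₁ hp₂')
      (by rintro rfl; exact c₂ hp₃') (by rintro rfl; exact c₁ hp₃)
      hp₁ hp₁' hp₂ hp₂' hp₃ hp₃' with h | h | h
    exacts [c₁ h, c₂ h, c₃ h]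
  · obtain ⟨x, y, hx, hy, hxy⟩ : ∃ x y, x ∈ T ∧ y ∈ T ∧ ∀ z ∈ T, z = x ∨ z = y := by
      obtain h1 | h1 : T.card = 1 ∨ T.card = 2 := by omega
      · obtain ⟨x, rfl⟩ := Finset.card_eq_one.1 h1
        exact ⟨x, x, by simp⟩
      · obtain ⟨x, y, -, rfl⟩ := Finset.card_eq_two.1 h1
        exact ⟨x, y, by simp⟩
    obtain ⟨b, hb, hbx, hby⟩ := hG.exists_adj_closer_pair v _ x y rfl (hlt x hx y hy)
    refine ⟨b, hb, fun z hz => ?_⟩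
    rcases hxy z hz with rfl | rfl
    exacts [hbx, hby]

theorem exists_adj_closer_set (hG : G.IsQuadric) (v : V) (hfin : (G.neighborSet v).Finite)
    {M : Set V} (hM : M.Nonempty)
    (hlt : ∀ x ∈ M, ∀ y ∈ M, G.dist y x < G.dist v x + G.dist v y) :
    ∃ b, G.Adj v b ∧ ∀ x ∈ M, G.dist x v = G.dist x b + 1 := by
  classical
  by_contra! hcon
  choose! f hf hf' using hcon
  obtain ⟨x₀, hx₀⟩ := hM
  have hT : ∀ x ∈ insert x₀ (hfin.toFinset.image f), x ∈ M := by
    intro x hx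
    rcases Finset.mem_insert.1 hx with rfl | hx
    · exact hx₀
    · obtain ⟨b, hb, rfl⟩ := Finset.mem_image.1 hx
      exact hf b (hfin.mem_toFinset.1 hb)
  obtain ⟨b, hb, hb'⟩ := hG.exists_adj_closer_finset v _ _ rfl
    (Finset.insert_nonempty x₀ (hfin.toFinset.image f))
    fun x hx y hy => hlt x (hT x hx) y (hT y hy)
  exact hf' b hb (hb' _ (Finset.mem_insert_of_mem
    (Finset.mem_image_of_mem f (hfin.mem_toFinset.2 hb))))

/-- The intersection of the balls of radius `R x` around all vertices `x`. -/
def ballInter (G : SimpleGraph V) (R : V → ℕ) : Set V := {p | ∀ x, G.dist x p ≤ R x}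

/-- If the balls of radius `R x` meet pairwise in an edge, and `v` violates the conditions
`dist x v ≤ R x` by at most `k`, then some neighbour of `v` violates them by at most `k - 1`. -/
theorem exists_adj_dist_le (hG : G.IsQuadric) (hfin : ∀ v, (G.neighborSet v).Finite)
    (hne : ∀ v, ∃ w, G.Adj v w) {R : V → ℕ} (hR : ∀ x y, G.dist x y + 1 ≤ R x + R y) {v : V}
    {k : ℕ} (hv : ∀ x, G.dist x v ≤ R x + k) :
    ∃ w, G.Adj v w ∧ ∀ x, G.dist x w ≤ R x + (k - 1) := by
  obtain ⟨w, hw, hw'⟩ : ∃ w, G.Adj v w ∧ ∀ x ∈ {x | R x + (k - 1) ≤ G.dist x v},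
      G.dist x v = G.dist x w + 1 := by
    rcases Set.eq_empty_or_nonempty {x | R x + (k - 1) ≤ G.dist x v} with h | h
    · obtain ⟨w, hw⟩ := hne v
      exact ⟨w, hw, by simp [h]⟩
    · refine hG.exists_adj_closer_set v (hfin v) h fun x hx y hy => ?_
      have := hR y x
      change R x + (k - 1) ≤ G.dist x v at hx
      change R y + (k - 1) ≤ G.dist y v at hy
      rw [dist_comm (u := v), dist_comm (u := v)]
      omega
  refine ⟨w, hw, fun x => ?_⟩
  by_cases hx : R x + (k - 1) ≤ G.dist x v
  · have := hw' x hx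
    have := hv x
    omega
  · have := hG.connected.dist_le_of_adj hw x
    omega

theorem ballInter_nonempty (hG : G.IsQuadric) (hfin : ∀ v, (G.neighborSet v).Finite)
    (hne : ∀ v, ∃ w, G.Adj v w) {R : V → ℕ} (hR : ∀ x y, G.dist x y + 1 ≤ R x + R y) :
    (ballInter G R).Nonempty := by
  have key : ∀ (k : ℕ) (v : V), (∀ x, G.dist x v ≤ R x + k) → (ballInter G R).Nonempty := by
    intro k
    induction k with
    | zero => exact fun v hv => ⟨v, hv⟩
    | succ k ih =>
      intro v hv
      obtain ⟨w, -, hw⟩ := hG.exists_adj_dist_le hfin hne hR hv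
      exact ih w hw
  have := hG.connected.nonempty
  obtain ⟨v⟩ := this
  exact key (R v) v fun x => by have := hR x v; omega

theorem finite_ball (hG : G.IsQuadric) (hfin : ∀ v, (G.neighborSet v).Finite) (o : V) (n : ℕ) :
    {p | G.dist o p ≤ n}.Finite := by
  induction n with
  | zero =>
    refine (Set.finite_singleton o).subset fun p hp => ?_
    exact (hG.connected.dist_eq_zero_iff.1 (Nat.le_zero.1 hp)).symm
  | succ n ih =>
    refine ((Set.finite_singleton o).union (ih.biUnion fun v _ => hfin v)).subset fun p hp => ?_
    by_cases hpo : p = o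
    · exact Or.inl hpo
    · obtain ⟨q, hq, hd⟩ := hG.connected.exists_adj_closer hpo
      have hp' : G.dist o p ≤ n + 1 := hp
      exact Or.inr (Set.mem_biUnion (show G.dist o q ≤ n by omega) hq.symm)

theorem finite_ballInter (hG : G.IsQuadric) (hfin : ∀ v, (G.neighborSet v).Finite) (R : V → ℕ) :
    (ballInter G R).Finite := by
  obtain ⟨o⟩ := hG.connected.nonempty
  exact (hG.finite_ball hfin o (R o)).subset fun p hp => hp o

theorem dist_smul {F : Type*} [Group F] [MulAction F V] (hG : G.IsQuadric)
    (hF : ∀ (f : F) (a b : V), G.Adj a b → G.Adj (f • a) (f • b)) (f : F) (a b : V) :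
    G.dist (f • a) (f • b) = G.dist a b := by
  have key : ∀ (f : F) (a b : V), G.dist (f • a) (f • b) ≤ G.dist a b := by
    intro f a b
    obtain ⟨p, hp⟩ := hG.connected.exists_walk_length_eq_dist a b
    let φ : G →g G := ⟨fun a => f • a, fun h => hF f _ _ h⟩
    rw [← hp, ← Walk.length_map φ p]
    exact dist_le _
  refine le_antisymm (key f a b) ?_
  simpa using key f⁻¹ (f • a) (f • b)

/-- A finite group acting on a locally finite quadric graph without isolated vertices stabilizes a
finite biclique, given as a set of diameter at most 2 without isolated vertices. It is the
intersection of balls whose radii are invariant and as small as possible. -/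
theorem exists_invariant_biclique {F : Type*} [Group F] [Finite F] [MulAction F V]
    (hG : G.IsQuadric) (hfin : ∀ v, (G.neighborSet v).Finite) (hne : ∀ v, ∃ w, G.Adj v w)
    (hF : ∀ (f : F) (a b : V), G.Adj a b → G.Adj (f • a) (f • b)) :
    ∃ C : Set V, C.Finite ∧ C.Nonempty ∧ (∀ (f : F), ∀ x ∈ C, f • x ∈ C) ∧
      (∀ p ∈ C, ∃ q ∈ C, G.Adj p q) ∧ ∀ p ∈ C, ∀ q ∈ C, G.dist p q ≤ 2 := by
  classical
  have inv : ∀ {R : V → ℕ}, (∀ (f : F) x, R (f • x) = R x) → ∀ (f : F) (p : V),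
      f • p ∈ ballInter G R ↔ p ∈ ballInter G R := by
    have : ∀ {R : V → ℕ}, (∀ (f : F) x, R (f • x) = R x) → ∀ (f : F) (p : V),
        p ∈ ballInter G R → f • p ∈ ballInter G R := by
      intro R hR f p hp x
      have := hp (f⁻¹ • x)
      rwa [hR, ← hG.dist_smul hF f, smul_inv_smul] at this
    exact fun {R} hR f p => ⟨fun h => by simpa using this hR f⁻¹ _ h, this hR f p⟩
  have key : ∀ (n : ℕ) (R : V → ℕ), (∀ (f : F) x, R (f • x) = R x) →
      (∀ x y, G.dist x y + 1 ≤ R x + R y) →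
      ∑ p ∈ (hG.finite_ballInter hfin R).toFinset, R p = n →
      ∃ R : V → ℕ, (∀ (f : F) x, R (f • x) = R x) ∧ (∀ x y, G.dist x y + 1 ≤ R x + R y) ∧
        ∀ p ∈ ballInter G R, R p ≤ 2 := by
    intro n
    induction n using Nat.strong_induction_on with
    | _ n ih =>
    intro R hinv hR hn
    by_cases hle : ∀ p ∈ ballInter G R, R p ≤ 2
    · exact ⟨R, hinv, hR, hle⟩
    push Not at hle
    obtain ⟨p₀, hp₀, hlt⟩ := hle
    -- Radii of at least 3 can be decreased at the points of the intersection.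
    let R' : V → ℕ := fun x => if x ∈ ballInter G R ∧ 3 ≤ R x then R x - 1 else R x
    have hR'le : ∀ x, R' x ≤ R x := fun x => by
      dsimp only [R']
      split_ifs <;> omega
    have hsub : ballInter G R' ⊆ ballInter G R := fun p hp x => (hp x).trans (hR'le x)
    refine ih _ ?_ R' (fun f x => ?_) (fun x y => ?_) rfl
    · rw [← hn]
      have h₀ : p₀ ∈ (hG.finite_ballInter hfin R).toFinset := by simpa using hp₀
      calc ∑ p ∈ (hG.finite_ballInter hfin R').toFinset, R' p
          ≤ ∑ p ∈ (hG.finite_ballInter hfin R).toFinset, R' p :=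
            Finset.sum_le_sum_of_subset (by simpa using hsub)
        _ < ∑ p ∈ (hG.finite_ballInter hfin R).toFinset, R p := by
            refine Finset.sum_lt_sum (fun p _ => hR'le p) ⟨p₀, h₀, ?_⟩
            dsimp only [R']
            rw [if_pos ⟨hp₀, hlt⟩]
            omega
    · dsimp only [R']
      rw [hinv, inv hinv]
    · have h := hR x y
      have hx : x ∈ ballInter G R → G.dist x y ≤ R y := fun h => by
        rw [dist_comm]
        exact h y
      have hy : y ∈ ballInter G R → G.dist x y ≤ R x := fun h => h x
      dsimp only [R']
      split_ifs with h₁ h₂ h₂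
      · have := hx h₁.1
        omega
      · have := hx h₁.1
        omega
      · have := hy h₂.1
        omega
      · exact h
  obtain ⟨o⟩ := hG.connected.nonempty
  have := Fintype.ofFinite F
  obtain ⟨R, hinv, hR, hle⟩ := key _ (fun x => ∑ f : F, G.dist (f • x) o + 1)
    (fun f x => by
      simp only [smul_smul]
      rw [Fintype.sum_equiv (Equiv.mulRight f) (fun h => G.dist ((h * f) • x) o)
        (fun h => G.dist (h • x) o) fun h => rfl])
    (fun x y => by
      have h₁ : ∀ x, G.dist x o ≤ ∑ f : F, G.dist (f • x) o := fun x => by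
        simpa using Finset.single_le_sum (f := fun f : F => G.dist (f • x) o)
          (fun _ _ => Nat.zero_le _) (Finset.mem_univ 1)
      have h₂ := hG.connected.dist_triangle (u := x) (v := o) (w := y)
      have h₃ : G.dist o y = G.dist y o := dist_comm
      have := h₁ x
      have := h₁ y
      omega) rfl
  refine ⟨ballInter G R, hG.finite_ballInter hfin R, hG.ballInter_nonempty hfin hne hR,
    fun f x hx => (inv hinv f x).2 hx, fun p hp => ?_, fun p hp q hq => (hq p).trans (hle p hp)⟩
  obtain ⟨q, hq, hq'⟩ := hG.exists_adj_dist_le hfin hne hR (k := 0) hp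
  exact ⟨q, hq', hq⟩

end IsQuadric

end SimpleGraph

/-! ### The 1-skeleton of the universal cover is a quadric graph -/

/-- A function which vanishes only at `o`, varies by at most one along edges and can be decreased
along an edge at every other vertex is the distance from `o`. -/
theorem SimpleGraph.dist_eq_of_descent {V : Type u} {G : SimpleGraph V} {o : V} {l : V → ℕ}
    (h₀ : ∀ a, l a = 0 ↔ o = a) (h₁ : ∀ a b, G.Adj a b → l b ≤ l a + 1)
    (h₂ : ∀ a, o ≠ a → ∃ b, G.Adj a b ∧ l a = l b + 1) (a : V) :
    G.Reachable o a ∧ G.dist o a = l a := by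
  have le : ∀ (n : ℕ) (a : V), l a = n → ∃ p : G.Walk o a, p.length = n := by
    intro n
    induction n with
    | zero =>
      intro a ha
      obtain rfl := (h₀ a).1 ha
      exact ⟨.nil, rfl⟩
    | succ n ih =>
      intro a ha
      obtain ⟨b, hb, hl⟩ := h₂ a fun h => by have := (h₀ a).2 h; omega
      obtain ⟨p, hp⟩ := ih b (by omega)
      exact ⟨p.concat hb.symm, by simp [hp]⟩
  have ge : ∀ {a b : V} (p : G.Walk a b), l b ≤ l a + p.length := by
    intro a b p
    induction p with
    | nil => simp
    | cons h p ih =>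
      have := h₁ _ _ h
      rw [SimpleGraph.Walk.length_cons]
      omega
  obtain ⟨p, hp⟩ := le _ a rfl
  refine ⟨p.reachable, le_antisymm (hp ▸ SimpleGraph.dist_le p) ?_⟩
  obtain ⟨q, hq⟩ := p.reachable.exists_walk_length_eq_dist
  have := ge q
  rw [(h₀ o).2 rfl, hq] at this
  omega

namespace SquareComplex

variable {X : SquareComplex.{u}} {x : X.Vert}

theorem UStep.ne (hX : X.IsLocallyQuadric) {a b : UVert X x} {e : X.Edge} (h : UStep a e b) :
    a ≠ b := by
  rintro rfl
  have := h.coverDist_eq (hX := hX) (a := a)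
  omega

/-- The 1-skeleton of the universal cover, as a simple graph. -/
def coverGraph (hX : X.IsLocallyQuadric) (x : X.Vert) : SimpleGraph (UVert X x) where
  Adj a b := ∃ e, UStep a e b
  symm := ⟨fun _ _ ⟨e, h⟩ => ⟨X.rev e, h.symm⟩⟩
  loopless := ⟨fun _ ⟨_, h⟩ => h.ne hX rfl⟩

theorem coverGraph_dist (hX : X.IsLocallyQuadric) (a b : UVert X x) :
    (coverGraph hX x).Reachable a b ∧ (coverGraph hX x).dist a b = coverDist hX a b := by
  refine SimpleGraph.dist_eq_of_descent (fun b => coverDist_eq_zero) ?_ ?_ b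
  · rintro b c ⟨e, h⟩
    have := h.coverDist_eq (hX := hX) (a := a)
    omega
  · intro b h
    obtain ⟨e, c, hc, hl⟩ := exists_descent (hX := hX) h
    exact ⟨c, ⟨e, hc⟩, hl⟩

/-- Every embedded 4-cycle of the universal cover bounds a square. -/
theorem UStep.boundsSquare (hX : X.IsLocallyQuadric) {v a b p : UVert X x} {e f g k : X.Edge}
    (he : UStep v e a) (hg : UStep a g p) (hf : UStep v f b) (hk : UStep b k p) (hab : a ≠ b)
    (hvp : v ≠ p) : X.BoundsSquare e g (X.rev k) (X.rev f) := by
  have h₀ : coverDist hX v v = 0 := coverDist_eq_zero.2 rfl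
  have ha := he.coverDist_eq (hX := hX) (a := v)
  have hb := hf.coverDist_eq (hX := hX) (a := v)
  have hp := hg.coverDist_eq (hX := hX) (a := v)
  have hp₀ : coverDist hX v p ≠ 0 := fun h => hvp (coverDist_eq_zero.1 h)
  obtain ⟨g', k', d, hg', hk', hs, hl⟩ := quadrangle (hX := hX) (o := v) hg.symm hk.symm (by omega)
    (by omega) fun h => hab (hg.symm.unique (h ▸ hk.symm))
  obtain rfl : v = d := coverDist_eq_zero.1 (show coverDist hX v d = 0 by omega)
  obtain rfl := hg'.edge_unique hX he.symm
  obtain rfl := hk'.edge_unique hX hf.symm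
  have := hs.reverse.rotate.rotate
  simpa only [X.rev_rev] using this

theorem coverGraph_isQuadric (hX : X.IsLocallyQuadric) (x : X.Vert) :
    (coverGraph hX x).IsQuadric where
  connected :=
    haveI : Nonempty (UVert X x) := ⟨UVert.base X x⟩
    ⟨fun a b => (coverGraph_dist hX a b).1⟩
  dist_ne := by
    rintro o a b ⟨e, h⟩
    rw [(coverGraph_dist hX o a).2, (coverGraph_dist hX o b).2]
    have := h.coverDist_eq (hX := hX) (a := o)
    omega
  quadrangle := by
    rintro o a b c ⟨e, he⟩ ⟨f, hf⟩ hbc hb hc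
    rw [(coverGraph_dist hX o a).2, (coverGraph_dist hX o _).2] at hb hc
    obtain ⟨g, k, d, hg, hk, -, hl⟩ := SquareComplex.quadrangle (hX := hX) (o := o) he hf hb hc
      fun h => hbc (he.unique (h ▸ hf))
    refine ⟨d, ⟨g, hg⟩, ⟨k, hk⟩, ?_⟩
    rwa [(coverGraph_dist hX o b).2, (coverGraph_dist hX o d).2]
  hexagon := by
    rintro v a₁ a₂ a₃ p₁ p₂ p₃ ⟨x₁, h₁⟩ ⟨x₂, h₂⟩ ⟨x₃, h₃⟩ n₁₂ n₂₃ n₃₁ v₁ v₂ v₃ m₁₂ m₂₃ m₃₁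
      ⟨s₂₁, h₂₁⟩ ⟨s₃₁, h₃₁⟩ ⟨s₃₂, h₃₂⟩ ⟨s₁₂, h₁₂⟩ ⟨s₁₃, h₁₃⟩ ⟨s₂₃, h₂₃⟩
    have B₁ := UStep.boundsSquare hX h₁ h₁₃ h₂ h₂₃ n₁₂ v₃
    have B₂ := UStep.boundsSquare hX h₂ h₂₁ h₃ h₃₁ n₂₃ v₁
    have B₃ := UStep.boundsSquare hX h₃ h₃₂ h₁ h₁₂ n₃₁ v₂
    rcases BoundsSquare.glue_three hX B₁ B₂ B₃
      (fun h => m₃₁ (h₂₃.unique (by rw [X.rev_rev] at h; exact h ▸ h₂₁)))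
      (fun h => m₁₂ (h₃₁.unique (by rw [X.rev_rev] at h; exact h ▸ h₃₂)))
      (fun h => m₂₃ (h₁₂.unique (by rw [X.rev_rev] at h; exact h ▸ h₁₃))) with
      ⟨d, q, -⟩ | ⟨d, q, -⟩ | ⟨d, q, -⟩
    · exact Or.inl ⟨_, (UStep.close_square q h₁₃ h₂₃.symm h₂₁).symm⟩
    · exact Or.inr (Or.inr ⟨_, UStep.close_square q h₂₃.symm h₂₁ h₃₁.symm⟩)
    · exact Or.inr (Or.inl ⟨_, (UStep.close_square q h₂₁ h₃₁.symm h₃₂).symm⟩)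

theorem finite_neighborSet_coverGraph (hX : X.IsLocallyQuadric) (a : UVert X x) :
    ((coverGraph hX x).neighborSet a).Finite := by
  refine ((hX.locallyFinite.finite_edge a.1).biUnion (t := fun e => {b | UStep a e b})
    fun e _ => Set.Subsingleton.finite fun b hb c hc => hb.unique hc).subset ?_
  rintro b ⟨e, he⟩
  exact Set.mem_biUnion he.src_eq he

/-! ### The action of the fundamental group on the universal cover -/

/-- The fundamental group acts on the universal cover by precomposition with the inverse. -/
instance (x : X.Vert) : MulAction (X.Pi1 x) (UVert X x) where
  smul g a := ⟨a.1, g.inv ≫ a.2⟩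
  one_smul a := Sigma.ext rfl (heq_of_eq (Category.id_comp a.2))
  mul_smul g h a := Sigma.ext rfl (heq_of_eq (Category.assoc g.inv h.inv a.2))

theorem UStep.smul {a b : UVert X x} {e : X.Edge} (g : X.Pi1 x) (h : UStep a e b) :
    UStep (g • a) e (g • b) :=
  h.translate g.inv

theorem eq_one_of_smul_eq {g : X.Pi1 x} {a : UVert X x} (h : g • a = a) : g = 1 := by
  obtain ⟨y, γ⟩ := a
  have h' : g.inv ≫ γ = γ := eq_of_heq (Sigma.mk.inj h).2
  have h'' : g.inv = 𝟙 _ := by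
    rw [← cancel_mono γ, Category.id_comp]
    exact h'
  have : g⁻¹ = 1 := Iso.ext h''
  exact inv_eq_one.1 this

/-- The fundamental group acts transitively on the fibres of the universal cover. -/
theorem exists_smul_eq {a b : UVert X x} (h : a.1 = b.1) : ∃ g : X.Pi1 x, g • a = b := by
  obtain ⟨y, γ⟩ := a
  obtain ⟨z, δ⟩ := b
  obtain rfl : y = z := h
  refine ⟨(asIso (δ ≫ inv γ)).symm, ?_⟩
  refine Sigma.ext rfl (heq_of_eq ?_)
  change (δ ≫ inv γ) ≫ γ = δ
  rw [Category.assoc, IsIso.inv_hom_id, Category.comp_id]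

theorem exists_uVert_over (hconn : X.IsConnected) (x y : X.Vert) : ∃ a : UVert X x, a.1 = y := by
  induction hconn x y with
  | refl => exact ⟨UVert.base X x, rfl⟩
  | tail _ h ih =>
    obtain ⟨a, rfl⟩ := ih
    obtain ⟨e, he, he'⟩ := h
    obtain ⟨b, hb⟩ := UStep.exists_of_src a e he
    exact ⟨b, hb.tgt_eq.symm.trans he'⟩

end SquareComplex

namespace SquareComplex

variable {X : SquareComplex.{u}} {x : X.Vert}

/-! ### Maps from square completions of graphs -/

section Graph

variable {V : Type v} {H : SimpleGraph V}

theorem dart_ext {d d' : H.Dart} (h : d.fst = d'.fst) (h' : d.snd = d'.snd) : d = d' :=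
  SimpleGraph.Dart.ext _ _ (Prod.ext h h')

/-- A permutation of the vertices of a graph which preserves adjacency induces a map of the square
completion. -/
def completionHom (σ : V → V) (hσ : Function.Injective σ)
    (hadj : ∀ i j, H.Adj i j → H.Adj (σ i) (σ j)) :
    Hom H.squareCompletion H.squareCompletion where
  onVert := σ
  onEdge d := ⟨(σ d.fst, σ d.snd), hadj _ _ d.adj⟩
  onFlag c := ⟨σ c.a, σ c.b, σ c.c, σ c.d, hadj _ _ c.adj_ab, hadj _ _ c.adj_bc, hadj _ _ c.adj_cd,
    hadj _ _ c.adj_da, hσ.ne c.a_ne_c, hσ.ne c.b_ne_d⟩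
  map_src _ := rfl
  map_rev _ := rfl
  map_first _ := rfl
  map_rot _ := rfl
  map_flip _ := rfl

/-- The automorphism of the square completion induced by a graph automorphism. -/
def completionAut (σ : Equiv.Perm V) (hadj : ∀ i j, H.Adj i j → H.Adj (σ i) (σ j))
    (hadj' : ∀ i j, H.Adj i j → H.Adj (σ.symm i) (σ.symm j)) : Automorphism H.squareCompletion where
  val := completionHom σ σ.injective hadj
  inv := completionHom σ.symm σ.symm.injective hadj'
  val_inv := Hom.ext (funext σ.apply_symm_apply)
    (funext fun d => dart_ext (σ.apply_symm_apply d.fst) (σ.apply_symm_apply d.snd))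
    (funext fun c => SimpleGraph.FourCycle.ext (σ.apply_symm_apply c.a) (σ.apply_symm_apply c.b)
      (σ.apply_symm_apply c.c) (σ.apply_symm_apply c.d))
  inv_val := Hom.ext (funext σ.symm_apply_apply)
    (funext fun d => dart_ext (σ.symm_apply_apply d.fst) (σ.symm_apply_apply d.snd))
    (funext fun c => SimpleGraph.FourCycle.ext (σ.symm_apply_apply c.a) (σ.symm_apply_apply c.b)
      (σ.symm_apply_apply c.c) (σ.symm_apply_apply c.d))

theorem hom_onEdge_snd (φ : Hom H.squareCompletion H.squareCompletion) (d : H.Dart) :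
    (φ.onEdge d : H.Dart).snd = φ.onVert d.snd := by
  have h := φ.map_src (d.symm : H.Dart)
  have h' := φ.map_rev d
  change φ.onEdge (d.symm : H.Dart) = (φ.onEdge d : H.Dart).symm at h'
  rw [h'] at h
  exact h

/-- A combinatorial self-map of a square completion is determined by its action on vertices. -/
theorem hom_eq_id (φ : Hom H.squareCompletion H.squareCompletion) (h : ∀ i, φ.onVert i = i) :
    φ = Hom.id _ := by
  have ha : ∀ c, (φ.onFlag c : H.FourCycle).a = φ.onVert c.a := fun c => by
    have h₁ := φ.map_src (H.squareCompletion.first c)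
    rw [φ.map_first] at h₁
    exact h₁
  have hr : ∀ c, φ.onFlag (H.squareCompletion.rot c) = H.squareCompletion.rot (φ.onFlag c) :=
    φ.map_rot
  have hb : ∀ c, (φ.onFlag c : H.FourCycle).b = φ.onVert c.b := fun c => by
    have := ha (H.squareCompletion.rot c)
    rw [hr] at this
    exact this
  have hc : ∀ c, (φ.onFlag c : H.FourCycle).c = φ.onVert c.c := fun c => by
    have := hb (H.squareCompletion.rot c)
    rw [hr] at this
    exact this
  have hd : ∀ c, (φ.onFlag c : H.FourCycle).d = φ.onVert c.d := fun c => by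
    have := hc (H.squareCompletion.rot c)
    rw [hr] at this
    exact this
  exact Hom.ext (funext h)
    (funext fun d => dart_ext ((φ.map_src d).trans (h _)) ((hom_onEdge_snd φ d).trans (h _)))
    (funext fun c => SimpleGraph.FourCycle.ext ((ha c).trans (h _)) ((hb c).trans (h _))
      ((hc c).trans (h _)) ((hd c).trans (h _)))

/-- An injective map of a graph to the 1-skeleton of the universal cover, which preserves
adjacency, extends to the square completion. The result is the composition with the projection
to `X`. -/
theorem exists_hom_of_cover (hX : X.IsLocallyQuadric) (ψ : V → UVert X x)
    (hψ : Function.Injective ψ) (hadj : ∀ i j, H.Adj i j → (coverGraph hX x).Adj (ψ i) (ψ j)) :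
    ∃ f : Hom H.squareCompletion X, (∀ i, f.onVert i = (ψ i).1) ∧
      ∀ d : H.Dart, UStep (ψ d.fst) (f.onEdge d) (ψ d.snd) := by
  choose E hE using hadj
  have hF : ∀ c : H.FourCycle, ∃ s, X.first s = E c.a c.b c.adj_ab ∧
      X.first (X.rot s) = E c.b c.c c.adj_bc ∧ X.first (X.rot (X.rot s)) = E c.c c.d c.adj_cd ∧
      X.first (X.rot (X.rot (X.rot s))) = E c.d c.a c.adj_da := fun c => by
    have := UStep.boundsSquare hX (hE _ _ c.adj_ab) (hE _ _ c.adj_bc) (hE _ _ c.adj_da).symm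
      (hE _ _ c.adj_cd).symm (hψ.ne c.b_ne_d) (hψ.ne c.a_ne_c)
    rwa [X.rev_rev, X.rev_rev] at this
  have hrev : ∀ i j (h : H.Adj i j), E j i h.symm = X.rev (E i j h) := fun i j h =>
    (hE j i h.symm).edge_unique hX (hE i j h).symm
  choose S h₀ h₁ h₂ h₃ using hF
  refine ⟨⟨fun i => (ψ i).1, fun d => E d.fst d.snd d.adj, S, fun d => (hE _ _ d.adj).src_eq,
    fun d => hrev _ _ d.adj, fun c => (h₀ c).symm, fun c => ?_, fun c => ?_⟩, fun _ => rfl,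
    fun d => hE _ _ d.adj⟩
  · exact flag_ext hX ((h₀ _).trans (h₁ c).symm) ((h₁ _).trans (h₂ c).symm)
      ((h₂ _).trans (h₃ c).symm)
  · exact flag_ext hX
      (((h₀ _).trans (hrev _ _ c.adj_da)).trans ((X.first_flip _).trans
        (congrArg X.rev (h₃ c))).symm)
      (((h₁ _).trans (hrev _ _ c.adj_cd)).trans ((first_rot_flip _).trans
        (congrArg X.rev (h₂ c))).symm)
      (((h₂ _).trans (hrev _ _ c.adj_bc)).trans ((first_rot_rot_flip _).trans
        (congrArg X.rev (h₁ c))).symm)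

/-- The extension of an injective map to the universal cover is an immersion after projection to `X`,
because lifts of paths to the universal cover are unique. -/
theorem isImmersion_of_cover {ψ : V → UVert X x} (hψ : Function.Injective ψ)
    {f : Hom H.squareCompletion X} (hf : ∀ d : H.Dart, UStep (ψ d.fst) (f.onEdge d) (ψ d.snd)) :
    f.IsImmersion := by
  have he : ∀ d d' : H.Dart, d.fst = d'.fst → f.onEdge d = f.onEdge d' → d = d' := by
    intro d d' h h'
    have k := hf d
    rw [h, h'] at k
    exact dart_ext h (hψ (k.unique (hf d')))
  refine ⟨he, fun q q' h h' => ?_⟩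
  have key : ∀ q q' : H.FourCycle, q.a = q'.a → f.onFlag q = f.onFlag q' → q.b = q'.b := by
    intro q q' h h'
    have := he (H.squareCompletion.first q) (H.squareCompletion.first q') h
      ((f.map_first q).trans ((congrArg X.first h').trans (f.map_first q').symm))
    exact congrArg (fun d : H.Dart => d.snd) this
  have hr : ∀ q q', f.onFlag q = f.onFlag q' →
      f.onFlag (H.squareCompletion.rot q) = f.onFlag (H.squareCompletion.rot q') :=
    fun q q' h => by rw [f.map_rot, f.map_rot, h]
  have hb := key q q' h h'
  have hc := key _ _ hb (hr _ _ h')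
  have hd := key _ _ hc (hr _ _ (hr _ _ h'))
  exact SimpleGraph.FourCycle.ext h hb hc hd

/-- An automorphism which acts on the image in the universal cover as a deck transformation commutes
with the projection to `X`. -/
theorem mem_aut_of_cover (hX : X.IsLocallyQuadric) {ψ : V → UVert X x}
    {f : Hom H.squareCompletion X} (hv : ∀ i, f.onVert i = (ψ i).1)
    (hf : ∀ d : H.Dart, UStep (ψ d.fst) (f.onEdge d) (ψ d.snd)) (g : X.Pi1 x)
    {φ : Automorphism H.squareCompletion} (hφ : ∀ i : V, ψ (φ.val.onVert i) = g • ψ i) :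
    φ ∈ f.aut := by
  change f.comp φ.val = f
  have he : ∀ d : H.Dart, f.onEdge (φ.val.onEdge d) = f.onEdge d := by
    intro d
    have h₁ := hf (φ.val.onEdge d)
    rw [show (φ.val.onEdge d : H.Dart).fst = _ from φ.val.map_src d, hom_onEdge_snd] at h₁
    have h₂ := (hf d).smul g
    rw [← hφ, ← hφ] at h₂
    exact h₁.edge_unique hX h₂
  have hq : ∀ q, X.first (f.onFlag (φ.val.onFlag q)) = X.first (f.onFlag q) := by
    intro q
    rw [← f.map_first, ← f.map_first, ← φ.val.map_first]
    exact he _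
  refine Hom.ext (funext fun i => ?_) (funext he) (funext fun q => ?_)
  · exact (hv _).trans ((congrArg Sigma.fst (hφ i)).trans (hv i).symm)
  · change f.onFlag (φ.val.onFlag q) = f.onFlag q
    refine flag_ext hX (hq q) ?_ ?_
    · have := hq (H.squareCompletion.rot q)
      rwa [φ.val.map_rot, f.map_rot, f.map_rot] at this
    · have := hq (H.squareCompletion.rot (H.squareCompletion.rot q))
      rwa [φ.val.map_rot, φ.val.map_rot, f.map_rot, f.map_rot, f.map_rot, f.map_rot] at this

end Graph

end SquareComplex

namespace SquareComplex

variable {X : SquareComplex.{u}} {x : X.Vert}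

/-! ### Torsion elements and bicliques -/

/-- A nontrivial element of the fundamental group does not exchange the ends of an edge of the
universal cover. -/
theorem not_swap (hX : X.IsLocallyQuadric) {g : X.Pi1 x} {p q : UVert X x}
    (h : (coverGraph hX x).Adj p q) (hp : g • p = q) (hq : g • q = p) : False := by
  obtain ⟨e, he⟩ := h
  have h₁ := he.smul g
  rw [hp, hq] at h₁
  exact X.rev_ne e (he.symm.edge_unique hX h₁)

/-- A nontrivial torsion element of the fundamental group stabilizes a biclique of the universal
cover with at least two vertices on both sides. -/
theorem exists_biclique (hX : X.IsLocallyQuadric) {g : X.Pi1 x} (hg : g ≠ 1)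
    (hfin : IsOfFinOrder g) :
    ∃ A B : Set (UVert X x), A.Finite ∧ B.Finite ∧ A.Nontrivial ∧ B.Nontrivial ∧ Disjoint A B ∧
      (∀ a ∈ A, ∀ b ∈ B, (coverGraph hX x).Adj a b) ∧
      (∀ a ∈ A, ∀ a' ∈ A, ¬ (coverGraph hX x).Adj a a') ∧
      (∀ b ∈ B, ∀ b' ∈ B, ¬ (coverGraph hX x).Adj b b') ∧
      (∀ p ∈ A ∪ B, g • p ∈ A ∪ B) ∧ ∀ p ∈ A ∪ B, g⁻¹ • p ∈ A ∪ B := by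
  classical
  have hG := coverGraph_isQuadric hX x
  have hne : ∀ a : UVert X x, a ≠ g • a := fun a h => hg (eq_one_of_smul_eq h.symm)
  have : Finite (Subgroup.zpowers g) := (finite_zpowers.2 hfin).to_subtype
  obtain ⟨C, hC, ⟨p, hp⟩, hinv, hadj, hdist⟩ := hG.exists_invariant_biclique
    (F := Subgroup.zpowers g) (finite_neighborSet_coverGraph hX)
    (fun a => by
      obtain ⟨b, hb, -⟩ := hG.connected.exists_adj_closer (hne a)
      exact ⟨b, hb⟩)
    (fun f a b ⟨e, he⟩ => ⟨e, he.smul f.1⟩)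
  have hgC : ∀ p ∈ C, g • p ∈ C := fun p hp => hinv ⟨g, Subgroup.mem_zpowers g⟩ p hp
  have hgC' : ∀ p ∈ C, g⁻¹ • p ∈ C := fun p hp =>
    hinv ⟨g⁻¹, (Subgroup.zpowers g).inv_mem (Subgroup.mem_zpowers g)⟩ p hp
  -- By parity, a third vertex of the biclique is adjacent to exactly one end of an edge.
  have one : ∀ {a b c}, a ∈ C → b ∈ C → c ∈ C → (coverGraph hX x).Adj a b →
      ¬ (coverGraph hX x).Adj a c → (coverGraph hX x).Adj b c := by
    intro a b c ha hb hc hab hac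
    have h₁ := hG.dist_adj hab c
    have h₂ := hdist c hc a ha
    have h₃ := hdist c hc b hb
    rw [← SimpleGraph.dist_eq_one_iff_adj, SimpleGraph.dist_comm] at hac ⊢
    omega
  have two : ∀ {a b c}, (coverGraph hX x).Adj a b → (coverGraph hX x).Adj a c →
      ¬ (coverGraph hX x).Adj b c := by
    intro a b c hab hac hbc
    have h₁ := hG.dist_adj hbc a
    rw [SimpleGraph.dist_eq_one_iff_adj.2 hab, SimpleGraph.dist_eq_one_iff_adj.2 hac] at h₁
    omega
  have other : ∀ p ∈ C, ∃ p' ∈ C, p' ≠ p ∧ ¬ (coverGraph hX x).Adj p p' := by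
    intro p hp
    by_contra! hcon
    have h₁ := hcon _ (hgC p hp) (hne p).symm
    by_cases h₂ : g • g • p = p
    · exact not_swap hX h₁ rfl h₂
    · have h₃ := hcon _ (hgC _ (hgC p hp)) h₂
      refine two h₁ h₃ ?_
      obtain ⟨e, he⟩ := h₁
      exact ⟨e, he.smul g⟩
  obtain ⟨q, hq, hpq⟩ := hadj p hp
  have hAB : {a | a ∈ C ∧ ¬ (coverGraph hX x).Adj p a} ∪ {b | b ∈ C ∧ (coverGraph hX x).Adj p b} =
      C := by
    ext a
    by_cases h : (coverGraph hX x).Adj p a <;> simp [h]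
  refine ⟨{a | a ∈ C ∧ ¬ (coverGraph hX x).Adj p a}, {b | b ∈ C ∧ (coverGraph hX x).Adj p b},
    hC.subset fun _ h => h.1, hC.subset fun _ h => h.1, ?_, ?_, ?_, ?_, ?_, ?_, ?_, ?_⟩
  · obtain ⟨p', hp', hne', hadj'⟩ := other p hp
    exact ⟨p, ⟨hp, SimpleGraph.irrefl _⟩, p', ⟨hp', hadj'⟩, hne'.symm⟩
  · obtain ⟨q', hq', hne', hadj'⟩ := other q hq
    exact ⟨q, ⟨hq, hpq⟩, q', ⟨hq', one hq hp hq' hpq.symm hadj'⟩, hne'.symm⟩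
  · exact Set.disjoint_left.2 fun a h h' => h.2 h'.2
  · exact fun a ha b hb => (one hp hb.1 ha.1 hb.2 ha.2).symm
  · intro a ha a' ha' h
    exact two (one hp hq ha.1 hpq ha.2) (one hp hq ha'.1 hpq ha'.2) h
  · exact fun b hb b' hb' => two hb.2 hb'.2
  · rw [hAB]
    exact hgC
  · rw [hAB]
    exact hgC'

theorem exists_bisimplex_of_hasTorsion (hX : X.IsLocallyQuadric) (h : HasTorsion (X.Pi1 x)) :
    ∃ m n : ℕ, 1 ≤ m ∧ 1 ≤ n ∧
      ∃ f : SquareComplex.Hom (bisimplexTwoSkeleton m n) X, f.IsImmersion ∧ f.aut ≠ ⊥ := by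
  obtain ⟨g, hg, hfin⟩ := h
  obtain ⟨A, B, hA, hB, hA', hB', hdisj, hAB, hAA, hBB, hinv, hinv'⟩ := exists_biclique hX hg hfin
  have hcard : ∀ {S : Set (UVert X x)}, S.Finite → S.Nontrivial →
      ∃ m, 1 ≤ m ∧ Nonempty (Fin (m + 1) ≃ S) := by
    intro S hS hS'
    have := hS.fintype
    have hc : 1 < Fintype.card S := by
      have := hS'.coe_sort
      exact Fintype.one_lt_card
    refine ⟨Fintype.card S - 1, by omega, ⟨(Fintype.equivFinOfCardEq ?_).symm⟩⟩
    omega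
  obtain ⟨m, hm, ⟨α⟩⟩ := hcard hA hA'
  obtain ⟨n, hn, ⟨β⟩⟩ := hcard hB hB'
  -- The vertices of the bisimplex, identified with those of the biclique.
  let Ψ : Fin (m + 1) ⊕ Fin (n + 1) ≃ (A ∪ B : Set (UVert X x)) := by
    classical exact (Equiv.sumCongr α β).trans (Equiv.Set.union hdisj).symm
  let ψ : Fin (m + 1) ⊕ Fin (n + 1) → UVert X x := fun i => (Ψ i).1
  have hψl : ∀ i, ψ (.inl i) = (α i).1 := fun i => by
    classical exact congrArg Subtype.val (Equiv.Set.union_symm_apply_left hdisj (α i))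
  have hψr : ∀ j, ψ (.inr j) = (β j).1 := fun j => by
    classical exact congrArg Subtype.val (Equiv.Set.union_symm_apply_right hdisj (β j))
  have hψ : Function.Injective ψ := Subtype.val_injective.comp Ψ.injective
  have hadj : ∀ i j, (completeBipartiteGraph (Fin (m + 1)) (Fin (n + 1))).Adj i j ↔
      (coverGraph hX x).Adj (ψ i) (ψ j) := by
    rintro (i | i) (j | j)
    · simpa [hψl] using hAA _ (α i).2 _ (α j).2
    · simpa [hψl, hψr] using hAB _ (α i).2 _ (β j).2
    · simpa [hψl, hψr] using (hAB _ (α j).2 _ (β i).2).symm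
    · simpa [hψr] using hBB _ (β i).2 _ (β j).2
  obtain ⟨f, hv, hf⟩ := exists_hom_of_cover hX ψ hψ fun i j h => (hadj i j).1 h
  let τ : Equiv.Perm (A ∪ B : Set (UVert X x)) :=
    ⟨fun p => ⟨g • p.1, hinv _ p.2⟩, fun p => ⟨g⁻¹ • p.1, hinv' _ p.2⟩,
      fun p => Subtype.ext (inv_smul_smul g p.1), fun p => Subtype.ext (smul_inv_smul g p.1)⟩
  let σ : Equiv.Perm (Fin (m + 1) ⊕ Fin (n + 1)) := (Ψ.trans τ).trans Ψ.symm
  have hσ : ∀ i, ψ (σ i) = g • ψ i := fun i => by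
    change (Ψ (Ψ.symm (τ (Ψ i)))).1 = _
    rw [Equiv.apply_symm_apply]
    rfl
  have hσ' : ∀ i, ψ (σ.symm i) = g⁻¹ • ψ i := fun i => by
    rw [eq_inv_smul_iff, ← hσ, Equiv.apply_symm_apply]
  refine ⟨m, n, hm, hn, f, isImmersion_of_cover hψ hf, fun hbot => ?_⟩
  have hmem := mem_aut_of_cover hX hv hf g (φ := completionAut σ
    (fun i j h => by
      rw [hadj, hσ, hσ]
      obtain ⟨e, he⟩ := (hadj i j).1 h
      exact ⟨e, he.smul g⟩)
    (fun i j h => by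
      rw [hadj, hσ', hσ']
      obtain ⟨e, he⟩ := (hadj i j).1 h
      exact ⟨e, he.smul g⁻¹⟩)) hσ
  rw [hbot, Subgroup.mem_bot] at hmem
  have h0 : σ (.inl 0) = .inl 0 :=
    congrArg (fun φ : Automorphism (bisimplexTwoSkeleton m n) => φ.val.onVert (.inl 0)) hmem
  have := hσ (.inl 0)
  rw [h0] at this
  exact hg (eq_one_of_smul_eq this.symm)

/-! ### Lifts of maps from bisimplices -/

theorem Hom.boundsSquare {Y : SquareComplex.{v}} (f : Hom Y X) (q : Y.Flag) :
    X.BoundsSquare (f.onEdge (Y.first q)) (f.onEdge (Y.first (Y.rot q)))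
      (f.onEdge (Y.first (Y.rot (Y.rot q)))) (f.onEdge (Y.first (Y.rot (Y.rot (Y.rot q))))) :=
  ⟨f.onFlag q, by simp only [f.map_first, f.map_rot, and_self]⟩

section Lift

variable {m n : ℕ} {f : Hom (bisimplexTwoSkeleton m n) X}

/-- The edges of the bisimplex, as oriented edges of its 2-skeleton. -/
def crossEdge (i : Fin (m + 1)) (j : Fin (n + 1)) : (bisimplexTwoSkeleton m n).Edge :=
  (⟨(.inl i, .inr j), by simp⟩ : (completeBipartiteGraph (Fin (m + 1)) (Fin (n + 1))).Dart)

/-- `F` lifts the map `f` to the universal cover. -/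
def IsLift (f : Hom (bisimplexTwoSkeleton m n) X) (F : Fin (m + 1) ⊕ Fin (n + 1) → UVert X x) :
    Prop :=
  ∀ i j, UStep (F (.inl i)) (f.onEdge (crossEdge i j)) (F (.inr j))

theorem src_crossEdge (f : Hom (bisimplexTwoSkeleton m n) X) (i : Fin (m + 1)) (j : Fin (n + 1)) :
    X.src (f.onEdge (crossEdge i j)) = f.onVert (.inl i) :=
  f.map_src _

theorem tgt_crossEdge (f : Hom (bisimplexTwoSkeleton m n) X) (i : Fin (m + 1)) (j : Fin (n + 1)) :
    X.tgt (f.onEdge (crossEdge i j)) = f.onVert (.inr j) := by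
  rw [tgt, ← f.map_rev, f.map_src]
  rfl

theorem IsLift.fst_eq {F : Fin (m + 1) ⊕ Fin (n + 1) → UVert X x} (h : IsLift f F) :
    ∀ i, (F i).1 = f.onVert i
  | .inl i => (h i 0).src_eq.symm.trans (src_crossEdge f i 0)
  | .inr j => (h 0 j).tgt_eq.symm.trans (tgt_crossEdge f 0 j)

theorem IsLift.ext {F F' : Fin (m + 1) ⊕ Fin (n + 1) → UVert X x} (h : IsLift f F)
    (h' : IsLift f F') (h₀ : F (.inl 0) = F' (.inl 0)) : F = F' := by
  have hr : ∀ j, F (.inr j) = F' (.inr j) := fun j => (h 0 j).unique (h₀ ▸ h' 0 j)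
  funext i
  rcases i with i | j
  · have h₁ := (h i 0).symm
    rw [hr] at h₁
    exact h₁.unique (h' i 0).symm
  · exact hr j

/-- Maps from bisimplices lift to the universal cover. The lift is determined along the edges at
`inl 0` and `inr 0`, and every other edge closes a square. -/
theorem exists_isLift (f : Hom (bisimplexTwoSkeleton m n) X) (a : UVert X x)
    (ha : a.1 = f.onVert (.inl 0)) : ∃ F, IsLift f F ∧ F (.inl 0) = a := by
  choose R hR using fun j : Fin (n + 1) =>
    UStep.exists_of_src a (f.onEdge (crossEdge 0 j)) ((src_crossEdge f 0 j).trans ha.symm)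
  choose L hL using fun i : Fin (m + 1) =>
    UStep.exists_of_src (R 0) (X.rev (f.onEdge (crossEdge i 0)))
      ((tgt_crossEdge f i 0).trans ((tgt_crossEdge f 0 0).symm.trans (hR 0).tgt_eq))
  have hL₀ : L 0 = a := (hL 0).unique (hR 0).symm
  refine ⟨Sum.elim L R, fun i j => ?_, hL₀⟩
  change UStep (L i) _ (R j)
  by_cases hi : i = 0
  · subst hi
    rw [hL₀]
    exact hR j
  by_cases hj : j = 0
  · subst hj
    exact (hL i).of_rev
  -- The square `inr j, inl 0, inr 0, inl i` closes up.
  let c : (completeBipartiteGraph (Fin (m + 1)) (Fin (n + 1))).FourCycle :=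
    ⟨.inr j, .inl 0, .inr 0, .inl i, by simp, by simp, by simp, by simp, by simpa using hj,
      by simpa using Ne.symm hi⟩
  have hB : X.BoundsSquare (f.onEdge ((bisimplexTwoSkeleton m n).rev (crossEdge 0 j)))
      (f.onEdge (crossEdge 0 0)) (f.onEdge ((bisimplexTwoSkeleton m n).rev (crossEdge i 0)))
      (f.onEdge (crossEdge i j)) := f.boundsSquare c
  rw [f.map_rev, f.map_rev] at hB
  exact UStep.close_square hB (hR j).symm (hR 0) (hL i)

/-- Lifts of immersions are injective, since the universal cover has no multiple edges. -/
theorem IsLift.injective (hX : X.IsLocallyQuadric) (hf : f.IsImmersion)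
    {F : Fin (m + 1) ⊕ Fin (n + 1) → UVert X x} (h : IsLift f F) : Function.Injective F := by
  rintro (i | j) (i' | j') hij
  · have h₁ := (h i 0).symm
    rw [hij] at h₁
    have h₂ := h₁.edge_unique hX (h i' 0).symm
    rw [← f.map_rev, ← f.map_rev] at h₂
    have h₃ := hf.edge_inj ((bisimplexTwoSkeleton m n).rev (crossEdge i 0))
      ((bisimplexTwoSkeleton m n).rev (crossEdge i' 0)) rfl h₂
    exact congrArg
      (fun d : (completeBipartiteGraph (Fin (m + 1)) (Fin (n + 1))).Dart => d.snd) h₃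
  · exact absurd hij ((h i j').ne hX)
  · exact absurd hij.symm ((h i' j).ne hX)
  · have h₁ := h 0 j
    rw [hij] at h₁
    have h₃ := hf.edge_inj (crossEdge 0 j) (crossEdge 0 j') rfl (h₁.edge_unique hX (h 0 j'))
    exact congrArg
      (fun d : (completeBipartiteGraph (Fin (m + 1)) (Fin (n + 1))).Dart => d.snd) h₃

theorem IsLift.uStep {F : Fin (m + 1) ⊕ Fin (n + 1) → UVert X x} (h : IsLift f F)
    (d : (completeBipartiteGraph (Fin (m + 1)) (Fin (n + 1))).Dart) :
    UStep (F d.fst) (f.onEdge d) (F d.snd) := by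
  obtain ⟨⟨i | i, j | j⟩, hd⟩ := d
  · simp at hd
  · exact h i j
  · have := (h j i).symm
    rw [← f.map_rev] at this
    exact this
  · simp at hd

end Lift

theorem hasTorsion_of_bisimplex (hX : X.IsLocallyQuadric) (hconn : X.IsConnected) {m n : ℕ}
    {f : Hom (bisimplexTwoSkeleton m n) X} (hf : f.IsImmersion) (haut : f.aut ≠ ⊥) :
    HasTorsion (X.Pi1 x) := by
  obtain ⟨⟨φ, hφ⟩, hφ₁⟩ := (Subgroup.ne_bot_iff_exists_ne_one).1 haut
  have hφ' : f.comp φ.val = f := hφ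
  obtain ⟨a, ha⟩ := exists_uVert_over hconn x (f.onVert (.inl 0))
  obtain ⟨F, hF, rfl⟩ := exists_isLift f a ha
  -- The automorphism moves the lift to another lift, hence acts as a deck transformation.
  have hFφ : IsLift f (F ∘ φ.val.onVert) := by
    intro i j
    have h₁ := hF.uStep (φ.val.onEdge (crossEdge i j))
    have h₂ : f.onEdge (φ.val.onEdge (crossEdge i j)) = f.onEdge (crossEdge i j) :=
      congrFun (congrArg Hom.onEdge hφ') _
    rw [h₂] at h₁
    have h₃ : (φ.val.onEdge (crossEdge i j) : SimpleGraph.Dart _).fst = φ.val.onVert (.inl i) :=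
      φ.val.map_src (crossEdge i j)
    have h₄ : (φ.val.onEdge (crossEdge i j) : SimpleGraph.Dart _).snd = φ.val.onVert (.inr j) :=
      hom_onEdge_snd φ.val (crossEdge i j)
    rw [h₃, h₄] at h₁
    exact h₁
  obtain ⟨g, hg⟩ := exists_smul_eq (a := F (.inl 0)) (b := F (φ.val.onVert (.inl 0)))
    ((hF.fst_eq _).trans ((congrFun (congrArg Hom.onVert hφ') (.inl 0)).symm.trans
      (hF.fst_eq _).symm))
  have key : (fun i => g • F i) = F ∘ φ.val.onVert :=
    IsLift.ext (fun i j => (hF i j).smul g) hFφ hg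
  have hinj := hF.injective hX hf
  refine ⟨g, ?_, ?_⟩
  · rintro rfl
    apply hφ₁
    refine Subtype.ext (Units.ext (hom_eq_id _ fun i => hinj ?_))
    have := congrFun key i
    rw [one_smul] at this
    exact this.symm
  · -- The permutation of the finitely many vertices has finite order.
    let σ : Fin (m + 1) ⊕ Fin (n + 1) → Fin (m + 1) ⊕ Fin (n + 1) := φ.val.onVert
    have hpow : ∀ (k : ℕ) i, F (σ^[k] i) = g ^ k • F i := by
      intro k
      induction k with
      | zero => simp
      | succ k ih =>
        intro i
        rw [Function.iterate_succ_apply', pow_succ', mul_smul, ← ih]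
        exact (congrFun key _).symm
    have hσ : Function.Injective σ := fun i j h => hinj (smul_left_cancel g
      ((congrFun key i).trans ((congrArg F h).trans (congrFun key j).symm)))
    obtain ⟨k, hk, hk'⟩ := hσ.mem_periodicPts (.inl 0)
    refine isOfFinOrder_iff_pow_eq_one.2 ⟨k, hk, eq_one_of_smul_eq (a := F (.inl 0)) ?_⟩
    rw [← hpow, hk']

end SquareComplex

theorem mainTheorem8 (X : SquareComplex.{u}) (hX : X.IsLocallyQuadric) (hcompact : X.IsCompact)
    (hconn : X.IsConnected) (x₀ : X.Vert) :
    HasTorsion (X.Pi1 x₀) ↔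
      ∃ m n : ℕ, 1 ≤ m ∧ 1 ≤ n ∧
        ∃ f : SquareComplex.Hom (bisimplexTwoSkeleton m n) X, f.IsImmersion ∧ f.aut ≠ ⊥ :=
  ⟨SquareComplex.exists_bisimplex_of_hasTorsion hX, fun ⟨_, _, _, _, _, hf, haut⟩ =>
    SquareComplex.hasTorsion_of_bisimplex hX hconn hf haut⟩
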